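/- For an $M\times N$ integer matrix $A$ ($M,N\ge 1$) let $\Sigma_{22}(A)$ be the $(M-1)\times(N-1)$ matrix of the sums of $A$ over all $2\times 2$ windows, $\Sigma_{22}(A)_{ij}=A_{i,j}+A_{i,j+1}+A_{i+1,j}+A_{i+1,j+1}$. The binary reconstruction problem is: given $M$, $N$ and an $(M-1)\times(N-1)$ integer matrix $S$, find a matrix $A\in\{0,1\}^{M\times N}$ with $\Sigma_{22}(A)=S$, or report that there is none. Theorem. The binary reconstruction problem is solvable in polynomial time; moreover, on a random access machine (RAM) it is solvable in $O(MN)$ time. Precisely, consider a RAM with integer registers and an integer memory, whose instructions are: load a constant, copy, add, subtract, multiply, indirect load and store, jump, jump if zero, jump if negative, and halt. There are one program for this machine, a constant $c$ and a polynomial $p$ such that for all $M,N\ge1$ and every $(M-1)\times(N-1)$ integer matrix $S$, the program, started with $M$, $N$ in two registers and the entries of $S$ in memory in row-major order (all else being zero), halts with a correct answer to the reconstruction problem (any one preimage $A$, or the report that none exists), and 1. it makes at most $c\,MN$ steps; 2. throughout the computation all registers and memory cells hold integers of absolute value at most $c\,(MN+\max_{i,j}|S_{ij}|)$ (the maximum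 being $0$ if $S$ has no entries), i.e. it uses words of $O(\log(MN+\max|S_{ij}|))$ bits; 3. its total logarithmic cost (each executed instruction is charged the binary length of its operands and of the memory address it uses) is at most $p(L)$, where $L$ is the length of the input, with the entries of $S$ written in binary and the dimensions in unary. -/

import Mathlib

/-! ### Random access machine with unit and logarithmic cost -/

namespace RAM

/-- Instructions of a random access machine. Registers are named by natural numbers (a program
mentions only finitely many of them) and hold integers, as do the cells of the memory. Jump targets
are positions in the program. -/
inductive Instr where
  /-- `reg d := z` -/
  | const (d : ℕ) (z : ℤ)
  /-- `reg d := reg a` -/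
  | copy (d a : ℕ)
  /-- `reg d := reg a + reg b` -/
  | add (d a b : ℕ)
  /-- `reg d := reg a - reg b` -/
  | sub (d a b : ℕ)
  /-- `reg d := reg a * reg b` -/
  | mul (d a b : ℕ)
  /-- `reg d := mem (reg a)` -/
  | load (d a : ℕ)
  /-- `mem (reg a) := reg b` -/
  | store (a b : ℕ)
  /-- go to position `l` -/
  | jump (l : ℕ)
  /-- go to position `l` if `reg a = 0` -/
  | jumpZero (a l : ℕ)
  /-- go to position `l` if `reg a < 0` -/
  | jumpNeg (a l : ℕ)
  | halt

/-- A program is a finite list of instructions; it does not depend on the input. -/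
abbrev Program := List Instr

/-- A configuration: program counter, registers, memory. -/
structure Config where
  pc : ℕ
  reg : ℕ → ℤ
  mem : ℕ → ℤ

/-- Write `z` into register `d` and move on to the next instruction. -/
def Config.setReg (s : Config) (d : ℕ) (z : ℤ) : Config :=
  { s with pc := s.pc + 1, reg := Function.update s.reg d z }

/-- Execution of one instruction. There is no next configuration after `halt`, nor after an access
to a negative address (a fault). -/
def exec (s : Config) : Instr → Option Config
  | .const d z => some (s.setReg d z)
  | .copy d a => some (s.setReg d (s.reg a))
  | .add d a b => some (s.setReg d (s.reg a + s.reg b))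
  | .sub d a b => some (s.setReg d (s.reg a - s.reg b))
  | .mul d a b => some (s.setReg d (s.reg a * s.reg b))
  | .load d a => if 0 ≤ s.reg a then some (s.setReg d (s.mem (s.reg a).toNat)) else none
  | .store a b =>
      if 0 ≤ s.reg a then
        some { s with pc := s.pc + 1, mem := Function.update s.mem (s.reg a).toNat (s.reg b) }
      else none
  | .jump l => some { s with pc := l }
  | .jumpZero a l => some { s with pc := if s.reg a = 0 then l else s.pc + 1 }
  | .jumpNeg a l => some { s with pc := if s.reg a < 0 then l else s.pc + 1 }
  | .halt => none

/-- Length of the binary notation of an integer, including a sign. -/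
def len (z : ℤ) : ℕ := Nat.size z.natAbs + 1

/-- Logarithmic cost of one instruction: the total length of its operands and of the memory
address it uses. -/
def logCost (s : Config) : Instr → ℕ
  | .const _ z => len z
  | .copy _ a => len (s.reg a)
  | .add _ a b => len (s.reg a) + len (s.reg b)
  | .sub _ a b => len (s.reg a) + len (s.reg b)
  | .mul _ a b => len (s.reg a) + len (s.reg b)
  | .load _ a => len (s.reg a) + len (s.mem (s.reg a).toNat)
  | .store a b => len (s.reg a) + len (s.reg b)
  | .jump _ => 1
  | .jumpZero a _ => len (s.reg a)
  | .jumpNeg a _ => len (s.reg a)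
  | .halt => 1

/-- `Run P s t w s'`: the program `P` leads from `s` to `s'` in `t` steps, whose total logarithmic
cost is `w`. -/
inductive Run (P : Program) : Config → ℕ → ℕ → Config → Prop
  | refl (s : Config) : Run P s 0 0 s
  | step {s s₁ s₂ : Config} {I : Instr} {t w : ℕ} (fetch : P[s.pc]? = some I)
      (next : exec s I = some s₁) (rest : Run P s₁ t w s₂) :
      Run P s (t + 1) (logCost s I + w) s₂

/-- The program has reached a `halt` instruction. -/
def Halted (P : Program) (s : Config) : Prop := P[s.pc]? = some .halt

/-- Every register and every memory cell holds a number of absolute value at most `B`. -/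
def Config.BoundedBy (s : Config) (B : ℕ) : Prop :=
  (∀ r, (s.reg r).natAbs ≤ B) ∧ ∀ a, (s.mem a).natAbs ≤ B

end RAM

/-! ### The binary reconstruction problem for `2 × 2` windows

The unknown matrix has `m + 1` rows and `n + 1` columns, so that the matrix of its window sums has
`m` rows and `n` columns. -/

namespace WindowSum

/-- The matrix of the sums of `A` over all `2 × 2` windows. -/
def windowSum {m n : ℕ} (A : Matrix (Fin (m + 1)) (Fin (n + 1)) ℤ) : Matrix (Fin m) (Fin n) ℤ :=
  fun i j => A i.castSucc j.castSucc + A i.castSucc j.succ + A i.succ j.castSucc + A i.succ j.succ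

/-- `A` is a 0-1 matrix whose matrix of window sums is `S`. -/
def IsPreimage {m n : ℕ} (S : Matrix (Fin m) (Fin n) ℤ)
    (A : Matrix (Fin (m + 1)) (Fin (n + 1)) ℤ) : Prop :=
  (∀ i j, A i j = 0 ∨ A i j = 1) ∧ windowSum A = S

/-- The initial configuration on input `S`: the dimensions of the unknown matrix are in registers
0 and 1, the entries of `S` are in row-major order in the memory cells `0, …, m * n - 1`, and
everything else is zero. -/
def input {m n : ℕ} (S : Matrix (Fin m) (Fin n) ℤ) : RAM.Config where
  pc := 0
  reg r := if r = 0 then (m : ℤ) + 1 else if r = 1 then (n : ℤ) + 1 else 0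
  mem a := if h : a < m * n then S (Fin.divNat ⟨a, h⟩) (Fin.modNat ⟨a, h⟩) else 0

/-- The `m × n` matrix that is stored in row-major order from cell `0` on. -/
def output (m n : ℕ) (s : RAM.Config) : Matrix (Fin m) (Fin n) ℤ :=
  fun i j => s.mem (i * n + j)

/-- The final configuration answers the reconstruction problem for `S`: either register 0 contains
`1` and the memory contains a preimage of `S`, or register 0 contains `0` and `S` has no
preimage. -/
def Answers {m n : ℕ} (S : Matrix (Fin m) (Fin n) ℤ) (s : RAM.Config) : Prop :=
  (s.reg 0 = 1 ∧ IsPreimage S (output (m + 1) (n + 1) s)) ∨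
    (s.reg 0 = 0 ∧ ¬ ∃ A, IsPreimage S A)

/-- The length of the input: the dimensions in unary notation and the entries of `S` in binary.
(The dimensions are in unary only for the sake of an `S` without entries, whose preimages are
matrices with a single row or column; otherwise the entries of `S` outweigh them.) -/
def inputLength {m n : ℕ} (S : Matrix (Fin m) (Fin n) ℤ) : ℕ :=
  (m + 1) + (n + 1) + ∑ i, ∑ j, RAM.len (S i j)

/-- The largest absolute value of an entry of `S` (zero if there are no entries). -/
def maxAbs {m n : ℕ} (S : Matrix (Fin m) (Fin n) ℤ) : ℕ :=
  Finset.univ.sup fun i => Finset.univ.sup fun j => (S i j).natAbs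

end WindowSum

/-! Flip every other entry: let F(i,j) be A(i,j) for even i+j and 1 - A(i,j) for odd i+j. The window
condition prescribes the mixed second differences (S(i,j) - 2)(-1)^(i+j) of F (`flip_mixedDiff`), so
F(i,j) = W(i,j) + x(i) + y(j), where W consists of their double sums (`eq_doubleSum_add`). The first
row of W is zero, so y may be taken to be the first row of F, with values in {0, 1}. What remains is
to choose such a y for which the entries of W + y differ by at most 1 within each row; x then comes
from subtracting row minima (`IsSolution.balanced`, `isSolution_of_flip`).

Normalise the rows of W to V, with row minima 0. In a row, offset 1 in a nonzero column forces
offset 1 in all zero columns, and an entry at least 2 forces this unconditionally. To propagate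
these implications without a queue, give a row the priority N + 1 minus its number of zeros, or N +
1 if it has an entry at least 2, and give a column the largest priority of a row vanishing there. If
all columns of priority at least q are forced and row i is nonzero in one of them, then all columns
of priority at least that of row i are forced (`Forced.lower`). For suppose that some y has offset 0
in a column where row k vanishes. Then row k vanishes wherever y is 1, in particular at all zeros of
row i and at one further column; so row k has more zeros, hence lower priority, than row i. One
sweep over the levels N, ..., 1 thus finds a threshold (`wp_threshold`). If offset 1 exactly on the
columns that reach it does not work, nothing does (`not_balanced_of_two_le`).

The algorithm is written in a loop language with weakest preconditions and compiled to the RAM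
(`leads_of_wp`). At most one row loop and one column loop are nested, so the time is O(MN). Input
entries outside 0, ..., 4 are clamped, which keeps the double sums of size O(MN). The logarithmic
cost is at most the number of steps times the word length, up to a constant (`Reach.run`). -/

/-! ### Bounded runs of the machine, their cost, and code placement. -/

namespace RAM

/-- `Reach P B s t s'`: the program `P` leads from `s` to `s'` in `t` steps, and all configurations
on the way, including both ends, are bounded by `B`. -/
inductive Reach (P : Program) (B : ℕ) : Config → ℕ → Config → Prop
  | refl {s : Config} (bdd : s.BoundedBy B) : Reach P B s 0 s
  | step {s s₁ s₂ : Config} {I : Instr} {t : ℕ} (bdd : s.BoundedBy B) (fetch : P[s.pc]? = some I)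
      (next : exec s I = some s₁) (rest : Reach P B s₁ t s₂) : Reach P B s (t + 1) s₂

variable {P : Program} {B : ℕ} {s s₁ s₂ : Config} {t t' : ℕ}

theorem Reach.trans (h : Reach P B s t s₁) (h' : Reach P B s₁ t' s₂) : Reach P B s (t + t') s₂ := by
  induction h with
  | refl _ => simpa using h'
  | step bdd fetch next _ ih =>
    rw [Nat.add_right_comm]
    exact .step bdd fetch next (ih h')

theorem Reach.left (h : Reach P B s t s₁) : s.BoundedBy B := by
  cases h <;> assumption

theorem Reach.right (h : Reach P B s t s₁) : s₁.BoundedBy B := by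
  induction h <;> assumption

theorem Reach.single {I : Instr} (bdd : s.BoundedBy B) (fetch : P[s.pc]? = some I)
    (next : exec s I = some s₁) (bdd₁ : s₁.BoundedBy B) : Reach P B s 1 s₁ :=
  .step bdd fetch next (.refl bdd₁)

theorem len_le {z : ℤ} (h : z.natAbs ≤ B) : len z ≤ B.size + 1 :=
  Nat.add_le_add_right (Nat.size_le_size h) 1

theorem logCost_le {I : Instr} (h : s.BoundedBy B) (hI : exec s I = some s₁)
    (h₁ : s₁.BoundedBy B) : logCost s I ≤ 2 * (B.size + 1) := by
  have hr : ∀ r, len (s.reg r) ≤ B.size + 1 := fun r => len_le (h.1 r)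
  have hm : ∀ a, len (s.mem a) ≤ B.size + 1 := fun a => len_le (h.2 a)
  cases I with
  | const d z =>
    simp only [exec, Option.some.injEq] at hI
    subst hI
    -- The literal need not occur in `s`; its length is bounded through the register that receives
    -- it.
    have := len_le (h₁.1 d)
    simp only [Config.setReg, Function.update_self] at this
    simp only [logCost]
    omega
  | copy d a => have := hr a; simp only [logCost]; omega
  | add d a b => have := hr a; have := hr b; simp only [logCost]; omega
  | sub d a b => have := hr a; have := hr b; simp only [logCost]; omega
  | mul d a b => have := hr a; have := hr b; simp only [logCost]; omega
  | load d a => have := hr a; have := hm (s.reg a).toNat; simp only [logCost]; omega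
  | store a b => have := hr a; have := hr b; simp only [logCost]; omega
  | jump l => simp only [logCost]; omega
  | jumpZero a l => have := hr a; simp only [logCost]; omega
  | jumpNeg a l => have := hr a; simp only [logCost]; omega
  | halt => simp only [logCost]; omega

theorem Reach.run (h : Reach P B s t s₁) :
    ∃ w, w ≤ t * (2 * (B.size + 1)) ∧ Run P s t w s₁ := by
  induction h with
  | refl _ => exact ⟨0, by simp, .refl _⟩
  | step bdd fetch next rest ih =>
    obtain ⟨w, hw, hrun⟩ := ih
    refine ⟨_, ?_, .step fetch next hrun⟩
    have := logCost_le bdd next rest.left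
    rw [add_mul, one_mul]
    omega

/-- Execution is deterministic, so any run from `s` is an initial piece of the run to the halted
`s₁`, which is bounded throughout. -/
theorem Reach.boundedBy_of_run (h : Reach P B s t s₁) (halted : Halted P s₁) {w : ℕ}
    (hr : Run P s t' w s₂) : s₂.BoundedBy B := by
  induction h generalizing t' w with
  | refl bdd =>
    cases hr with
    | refl => exact bdd
    | step fetch next _ =>
      rw [Halted] at halted
      rw [halted, Option.some.injEq] at fetch
      subst fetch
      simp [exec] at next
  | step bdd fetch next _ ih =>
    cases hr with
    | refl => exact bdd
    | step fetch' next' tail =>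
      rw [fetch, Option.some.injEq] at fetch'
      subst fetch'
      rw [next, Option.some.injEq] at next'
      subst next'
      exact ih halted tail

/-- The instructions of the list stand in the program from position `k` on. -/
def CodeAt (P : Program) : ℕ → List Instr → Prop
  | _, [] => True
  | k, I :: l => P[k]? = some I ∧ CodeAt P (k + 1) l

theorem codeAt_append {k : ℕ} {l l' : List Instr} :
    CodeAt P k (l ++ l') ↔ CodeAt P k l ∧ CodeAt P (k + l.length) l' := by
  induction l generalizing k with
  | nil => simp [CodeAt]
  | cons I l ih =>
    simp only [List.cons_append, CodeAt, ih, and_assoc, List.length_cons]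
    rw [show k + 1 + l.length = k + (l.length + 1) by omega]

theorem codeAt_suffix (l l' : List Instr) : CodeAt (l ++ l') l.length l' := by
  induction l' generalizing l with
  | nil => trivial
  | cons I l' ih =>
    refine ⟨by simp, ?_⟩
    simpa using ih (l ++ [I])

theorem codeAt_self : CodeAt P 0 P := codeAt_suffix [] P

theorem Config.BoundedBy.setReg (h : s.BoundedBy B) {z : ℤ} (hz : z.natAbs ≤ B) (d : ℕ) :
    (s.setReg d z).BoundedBy B := by
  refine ⟨fun r => ?_, h.2⟩
  by_cases hr : r = d
  · subst hr; simpa [Config.setReg] using hz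
  · simpa [Config.setReg, hr] using h.1 r

end RAM

/-! ### A structured language with loops and arrays -/

namespace ArrayProgram

open RAM

/-- Statements of a structured language. Its variables are named by natural numbers; it has five
arrays of format `M × N`, and loops that run over the row or the column indices. -/
inductive Stmt where
  | skip
  | const (d : ℕ) (z : ℤ)
  | copy (d a : ℕ)
  | add (d a b : ℕ)
  | sub (d a b : ℕ)
  | mul (d a b : ℕ)
  /-- variable `d` := number of rows (`true`) or columns (`false`) -/
  | dim (d : ℕ) (rows : Bool)
  /-- variable `d` := entry of array `k` whose indices are in the variables `i`, `j` -/
  | load (d k i j : ℕ)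
  /-- variable `d` := entry of array `0` whose row-major index is in the variable `p` -/
  | loadLin (d p : ℕ)
  /-- entry of array `k` whose indices are in the variables `i`, `j` := variable `a` -/
  | store (k i j a : ℕ)
  | seq (c c' : Stmt)
  | ifNeg (a : ℕ) (c c' : Stmt)
  | ifZero (a : ℕ) (c c' : Stmt)
  /-- run `c` with variable `r` counting the row (`true`) or column (`false`) indices -/
  | loop (r : ℕ) (rows : Bool) (c : Stmt)

infixr:60 ";;" => Stmt.seq

/-- A state: the values of the variables and of the array entries. -/
structure State where
  var : ℕ → ℤ
  arr : ℕ → ℕ → ℕ → ℤ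

/-- Assignment to a variable. -/
def State.set (s : State) (d : ℕ) (z : ℤ) : State :=
  { s with var := Function.update s.var d z }

/-- Assignment to an array entry. -/
def State.setArr (s : State) (k i j : ℕ) (z : ℤ) : State :=
  { s with arr := fun a b c => if a = k ∧ b = i ∧ c = j then z else s.arr a b c }

/-- The number of rows or of columns. -/
def extent (M N : ℕ) (rows : Bool) : ℕ := if rows then M else N

/-- Weakest precondition of `n` rounds of a loop whose counter `r` has the value `k`. -/
def wpIter (body : (State → Prop) → State → Prop) (r : ℕ) (Q : State → Prop) :
    ℕ → ℕ → State → Prop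
  | 0, _, s => Q s
  | n + 1, k, s =>
    body (fun s' => s'.var r = k ∧ wpIter body r Q n (k + 1) (s'.set r ((k : ℤ) + 1))) s

/-- Weakest precondition: array indices are in range, computed numbers are bounded by `B`, and the
final state satisfies `Q`. -/
def wp (M N B : ℕ) : Stmt → (State → Prop) → State → Prop
  | .skip, Q, s => Q s
  | .const d z, Q, s => z.natAbs ≤ B ∧ Q (s.set d z)
  | .copy d a, Q, s => Q (s.set d (s.var a))
  | .add d a b, Q, s => (s.var a + s.var b).natAbs ≤ B ∧ Q (s.set d (s.var a + s.var b))
  | .sub d a b, Q, s => (s.var a - s.var b).natAbs ≤ B ∧ Q (s.set d (s.var a - s.var b))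
  | .mul d a b, Q, s => (s.var a * s.var b).natAbs ≤ B ∧ Q (s.set d (s.var a * s.var b))
  | .dim d b, Q, s => Q (s.set d (extent M N b))
  | .load d k i j, Q, s => (k < 5 ∧ 0 ≤ s.var i ∧ s.var i < M ∧ 0 ≤ s.var j ∧ s.var j < N) ∧
      Q (s.set d (s.arr k (s.var i).toNat (s.var j).toNat))
  | .loadLin d p, Q, s => (0 ≤ s.var p ∧ s.var p < M * N) ∧
      Q (s.set d (s.arr 0 ((s.var p).toNat / N) ((s.var p).toNat % N)))
  | .store k i j a, Q, s => (k < 5 ∧ 0 ≤ s.var i ∧ s.var i < M ∧ 0 ≤ s.var j ∧ s.var j < N) ∧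
      Q (s.setArr k (s.var i).toNat (s.var j).toNat (s.var a))
  | .seq c c', Q, s => wp M N B c (wp M N B c' Q) s
  | .ifNeg a c c', Q, s => (s.var a < 0 → wp M N B c Q s) ∧ (0 ≤ s.var a → wp M N B c' Q s)
  | .ifZero a c c', Q, s => (s.var a = 0 → wp M N B c Q s) ∧ (s.var a ≠ 0 → wp M N B c' Q s)
  | .loop r b c, Q, s => wpIter (wp M N B c) r Q (extent M N b) 0 (s.set r 0)

/-- Bound for the running time. -/
def Stmt.time (M N : ℕ) : Stmt → ℕ
  | .skip => 0
  | .load .. | .store .. => 4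
  | .seq c c' => c.time M N + c'.time M N
  | .ifNeg _ c c' | .ifZero _ c c' => c.time M N + c'.time M N + 2
  | .loop _ b c => extent M N b * (c.time M N + 5) + 4
  | _ => 1

/-- Number of instructions of the compiled statement. -/
def Stmt.size : Stmt → ℕ
  | .skip => 0
  | .load .. | .store .. => 4
  | .seq c c' => c.size + c'.size
  | .ifNeg _ c c' | .ifZero _ c c' => c.size + c'.size + 2
  | .loop _ _ c => c.size + 7
  | _ => 1

/-- Register that holds the number of rows or of columns. -/
def extentReg (rows : Bool) : ℕ := if rows then 0 else 1

/-- Compilation, for a code that starts at position `k` of the program. Registers 0 and 1 hold the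
format, register 2 is for auxiliary results, registers 3 to 7 hold the base addresses of the arrays,
and variable `r` is in register `r + 8`. -/
def compile : Stmt → ℕ → List Instr
  | .skip, _ => []
  | .const d z, _ => [.const (d + 8) z]
  | .copy d a, _ => [.copy (d + 8) (a + 8)]
  | .add d a b, _ => [.add (d + 8) (a + 8) (b + 8)]
  | .sub d a b, _ => [.sub (d + 8) (a + 8) (b + 8)]
  | .mul d a b, _ => [.mul (d + 8) (a + 8) (b + 8)]
  | .dim d b, _ => [.copy (d + 8) (extentReg b)]
  | .load d k i j, _ => [.mul 2 (i + 8) 1, .add 2 2 (j + 8), .add 2 2 (k + 3), .load (d + 8) 2]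
  | .loadLin d p, _ => [.load (d + 8) (p + 8)]
  | .store k i j a, _ => [.mul 2 (i + 8) 1, .add 2 2 (j + 8), .add 2 2 (k + 3), .store 2 (a + 8)]
  | .seq c c', l => compile c l ++ compile c' (l + c.size)
  | .ifNeg a c c', l => .jumpNeg (a + 8) (l + c'.size + 2) :: (compile c' (l + 1) ++
      .jump (l + c'.size + c.size + 2) :: compile c (l + c'.size + 2))
  | .ifZero a c c', l => .jumpZero (a + 8) (l + c'.size + 2) :: (compile c' (l + 1) ++
      .jump (l + c'.size + c.size + 2) :: compile c (l + c'.size + 2))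
  | .loop r b c, l => .const (r + 8) 0 :: .sub 2 (r + 8) (extentReg b) :: .jumpNeg 2 (l + 4) ::
      .jump (l + c.size + 7) :: (compile c (l + 4) ++
      [.const 2 1, .add (r + 8) (r + 8) 2, .jump (l + 1)])

@[simp] theorem length_compile (c : Stmt) (l : ℕ) : (compile c l).length = c.size := by
  induction c generalizing l <;> simp [compile, Stmt.size, *] <;> omega

/-- The configuration `σ` represents the state `s`. -/
structure Rep (M N : ℕ) (s : State) (σ : Config) : Prop where
  rows : σ.reg 0 = M
  cols : σ.reg 1 = N
  base : ∀ k < 5, σ.reg (k + 3) = k * (M * N)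
  var : ∀ r, σ.reg (r + 8) = s.var r
  arr : ∀ k < 5, ∀ i < M, ∀ j < N, σ.mem (k * (M * N) + i * N + j) = s.arr k i j

variable {M N B : ℕ} {s : State} {σ : Config}

theorem Rep.setVar (h : Rep M N s σ) (d : ℕ) (z : ℤ) :
    Rep M N (s.set d z) (σ.setReg (d + 8) z) where
  rows := by simpa [Config.setReg] using h.rows
  cols := by simpa [Config.setReg] using h.cols
  base k hk := by
    simpa [Config.setReg, Function.update_of_ne (show k + 3 ≠ d + 8 by omega)] using h.base k hk
  var r := by
    by_cases hr : r = d
    · subst hr; simp [Config.setReg, State.set]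
    · simpa [Config.setReg, State.set, hr] using h.var r
  arr := h.arr

theorem Rep.setAux (h : Rep M N s σ) (z : ℤ) : Rep M N s (σ.setReg 2 z) where
  rows := by simpa [Config.setReg] using h.rows
  cols := by simpa [Config.setReg] using h.cols
  base k hk := by
    simpa [Config.setReg, Function.update_of_ne (show k + 3 ≠ 2 by omega)] using h.base k hk
  var r := by
    simpa [Config.setReg, Function.update_of_ne (show r + 8 ≠ 2 by omega)] using h.var r
  arr := h.arr

theorem Rep.setPc (h : Rep M N s σ) (l : ℕ) : Rep M N s { σ with pc := l } :=
  ⟨h.rows, h.cols, h.base, h.var, h.arr⟩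

theorem Rep.extentReg (h : Rep M N s σ) (b : Bool) :
    σ.reg (extentReg b) = extent M N b := by
  cases b
  · exact h.cols
  · exact h.rows

theorem mul_add_inj {N i i' j j' : ℕ} (hj : j < N) (hj' : j' < N)
    (h : i * N + j = i' * N + j') : i = i' ∧ j = j' := by
  have key : i = i' := by
    have h₁ : (i * N + j) / N = i := by
      rw [mul_comm, Nat.mul_add_div (by omega), Nat.div_eq_of_lt hj, add_zero]
    have h₂ : (i' * N + j') / N = i' := by
      rw [mul_comm, Nat.mul_add_div (by omega), Nat.div_eq_of_lt hj', add_zero]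
    rw [← h₁, ← h₂, h]
  subst key
  exact ⟨rfl, by omega⟩

theorem mul_add_lt {M N i j : ℕ} (hi : i < M) (hj : j < N) : i * N + j < M * N := by
  have : (i + 1) * N ≤ M * N := Nat.mul_le_mul_right N hi
  rw [add_mul, one_mul] at this
  omega

/-- An address is a mixed-radix expansion with digits `k`, `i`, `j`. This is why a store changes a
single array entry. -/
theorem address_inj {k k' i i' j j' : ℕ} (hi : i < M) (hi' : i' < M) (hj : j < N)
    (hj' : j' < N) (h : k * (M * N) + i * N + j = k' * (M * N) + i' * N + j') :
    k = k' ∧ i = i' ∧ j = j' := by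
  have h₁ := mul_add_lt hi hj
  have h₂ := mul_add_lt hi' hj'
  have := mul_add_inj h₁ h₂ (by rw [← add_assoc, ← add_assoc]; exact h)
  exact ⟨this.1, mul_add_inj hj hj' this.2⟩

theorem Rep.setMem (h : Rep M N s σ) {k i j : ℕ} (hi : i < M) (hj : j < N) (z : ℤ)
    (l : ℕ) : Rep M N (s.setArr k i j z)
      { σ with pc := l, mem := Function.update σ.mem (k * (M * N) + i * N + j) z } where
  rows := h.rows
  cols := h.cols
  base := h.base
  var := h.var
  arr k' hk' i' hi' j' hj' := by
    by_cases hc : k' = k ∧ i' = i ∧ j' = j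
    · obtain ⟨rfl, rfl, rfl⟩ := hc
      simp [State.setArr]
    · have hne : k' * (M * N) + i' * N + j' ≠ k * (M * N) + i * N + j :=
        fun he => hc (address_inj hi' hi hj' hj he)
      simpa only [State.setArr, if_neg hc, Function.update_of_ne hne] using
        (h.arr k' hk' i' hi' j' hj' :)

/-- The compiled statement, run from `σ`, ends within time `T` at position `l` in a configuration
that represents a state with the property `Q`. -/
def Leads (M N B : ℕ) (P : Program) (σ : Config) (T l : ℕ) (Q : State → Prop) : Prop :=
  ∃ t s' σ', t ≤ T ∧ Reach P B σ t σ' ∧ σ'.pc = l ∧ Rep M N s' σ' ∧ Q s'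

variable {P : Program} {Q Q' : State → Prop} {T T' l l' : ℕ}

theorem Leads.bind (h : Leads M N B P σ T l Q)
    (h' : ∀ s' σ', σ'.BoundedBy B → σ'.pc = l → Rep M N s' σ' → Q s' →
      Leads M N B P σ' T' l' Q') : Leads M N B P σ (T + T') l' Q' := by
  obtain ⟨t, s', σ', ht, hr, hpc, hrep, hQ⟩ := h
  obtain ⟨t', s'', σ'', ht', hr', hpc', hrep', hQ'⟩ := h' s' σ' hr.right hpc hrep hQ
  exact ⟨t + t', s'', σ'', by omega, hr.trans hr', hpc', hrep', hQ'⟩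

theorem Leads.step {I : Instr} {σ₁ : Config} (hb : σ.BoundedBy B) (fetch : P[σ.pc]? = some I)
    (next : exec σ I = some σ₁) (h : Leads M N B P σ₁ T l Q) :
    Leads M N B P σ (T + 1) l Q := by
  obtain ⟨t, s', σ', ht, hr, h⟩ := h
  exact ⟨t + 1, s', σ', by omega, .step hb fetch next hr, h⟩

theorem Leads.mono_time (h : Leads M N B P σ T l Q) (hT : T ≤ T') : Leads M N B P σ T' l Q := by
  obtain ⟨t, s', σ', ht, h⟩ := h
  exact ⟨t, s', σ', ht.trans hT, h⟩

theorem Leads.done (hb : σ.BoundedBy B) (hpc : σ.pc = l) (hrep : Rep M N s σ) (hQ : Q s) :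
    Leads M N B P σ 0 l Q :=
  ⟨0, s, σ, le_rfl, .refl hb, hpc, hrep, hQ⟩

theorem Leads.assign {I : Instr} {d : ℕ} {z : ℤ} (hb : σ.BoundedBy B)
    (fetch : P[σ.pc]? = some I) (next : exec σ I = some (σ.setReg (d + 8) z))
    (hz : z.natAbs ≤ B) (hrep : Rep M N s σ) (hQ : Q (s.set d z)) :
    Leads M N B P σ 1 (σ.pc + 1) Q :=
  .step hb fetch next (.done (hb.setReg hz _) rfl (hrep.setVar d z) hQ)

/-- The three instructions that compute an address. -/
theorem Leads.address {k i j : ℕ} {u v : ℕ} (hb : σ.BoundedBy B) (hB : 5 * (M * N) ≤ B)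
    (hrep : Rep M N s σ) (hk : k < 5) (hu : u < M) (hv : v < N) (hi : s.var i = u)
    (hj : s.var j = v)
    (hcode : CodeAt P σ.pc [.mul 2 (i + 8) 1, .add 2 2 (j + 8), .add 2 2 (k + 3)])
    (h : ∀ σ' : Config, σ'.BoundedBy B → σ'.pc = σ.pc + 3 → Rep M N s σ' →
      σ'.reg 2 = ((k * (M * N) + u * N + v : ℕ) : ℤ) → Leads M N B P σ' T l Q) :
    Leads M N B P σ (T + 3) l Q := by
  obtain ⟨f₁, f₂, f₃, -⟩ := hcode
  have huv := mul_add_lt hu hv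
  have hk4 : k * (M * N) ≤ 4 * (M * N) := Nat.mul_le_mul_right _ (by omega)
  have b₁ : (((u * N : ℕ) : ℤ)).natAbs ≤ B := by rw [Int.natAbs_natCast]; omega
  have b₂ : (((u * N + v : ℕ) : ℤ)).natAbs ≤ B := by rw [Int.natAbs_natCast]; omega
  have b₃ : (((k * (M * N) + u * N + v : ℕ) : ℤ)).natAbs ≤ B := by
    rw [Int.natAbs_natCast]; omega
  have e₁ : exec σ (.mul 2 (i + 8) 1) = some (σ.setReg 2 ((u * N : ℕ) : ℤ)) := by
    simp [exec, hrep.var, hi, hrep.cols]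
  have r₁ := hrep.setAux ((u * N : ℕ) : ℤ)
  have h₁ := hb.setReg b₁ 2
  have e₂ : exec (σ.setReg 2 ((u * N : ℕ) : ℤ)) (.add 2 2 (j + 8)) =
      some ((σ.setReg 2 ((u * N : ℕ) : ℤ)).setReg 2 ((u * N + v : ℕ) : ℤ)) := by
    simp only [exec, r₁.var, hj]
    simp [Config.setReg]
  have r₂ := r₁.setAux ((u * N + v : ℕ) : ℤ)
  have h₂ := h₁.setReg b₂ 2
  have e₃ : exec ((σ.setReg 2 ((u * N : ℕ) : ℤ)).setReg 2 ((u * N + v : ℕ) : ℤ))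
      (.add 2 2 (k + 3)) = some (((σ.setReg 2 ((u * N : ℕ) : ℤ)).setReg 2
        ((u * N + v : ℕ) : ℤ)).setReg 2 ((k * (M * N) + u * N + v : ℕ) : ℤ)) := by
    simp only [exec, r₂.base k hk]
    simp [Config.setReg]
    ring_nf
  exact ((((h _ (h₂.setReg b₃ 2) rfl (r₂.setAux _) (by simp [Config.setReg])).step
    h₂ f₃ e₃).step h₁ f₂ e₂).step hb f₁ e₁)

/-- Induction on the number `n` of rounds left. Besides the body a round takes five instructions
(subtract, branch, load 1, increment, jump back), and leaving the loop takes three. -/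
theorem leads_of_wpIter {c : Stmt} {r : ℕ} {b : Bool}
    (hB : extent M N b ≤ B) (hB1 : 1 ≤ B)
    (hcode : CodeAt P l (compile (.loop r b c) l))
    (ih : ∀ (Q : State → Prop) (s : State) (σ : Config), σ.BoundedBy B → Rep M N s σ →
      σ.pc = l + 4 → wp M N B c Q s → Leads M N B P σ (c.time M N) (l + 4 + c.size) Q)
    (n k : ℕ) (hn : k + n = extent M N b) (hb : σ.BoundedBy B) (hrep : Rep M N s σ)
    (hpc : σ.pc = l + 1) (hk : s.var r = k) (h : wpIter (wp M N B c) r Q n k s) :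
    Leads M N B P σ (n * (c.time M N + 5) + 3) (l + c.size + 7) Q := by
  simp only [compile, CodeAt, codeAt_append, length_compile, and_true] at hcode
  obtain ⟨-, f₁, f₂, f₃, -, f₄, f₅, f₆⟩ := hcode
  induction n generalizing k s σ with
  | zero =>
    have b₁ : (0 : ℤ).natAbs ≤ B := by simp
    have e₁ : exec σ (.sub 2 (r + 8) (extentReg b)) = some (σ.setReg 2 0) := by
      simp only [exec, hrep.var, hk, hrep.extentReg, Option.some.injEq]
      rw [show k = extent M N b by omega, sub_self]
    have h₁ := hb.setReg b₁ 2
    have r₁ := hrep.setAux 0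
    refine (Leads.step (T := 2) hb (by rw [hpc]; exact f₁) e₁ (Leads.step (I := .jumpNeg 2 (l + 4))
      (σ₁ := { σ.setReg 2 0 with pc := l + 3 }) (T := 1) h₁ ?_ ?_
      (Leads.step (I := .jump (l + c.size + 7))
        (σ₁ := { σ.setReg 2 0 with pc := l + c.size + 7 }) (T := 0) ⟨h₁.1, h₁.2⟩ ?_ ?_
        (.done ⟨h₁.1, h₁.2⟩ rfl (r₁.setPc _) h)))).mono_time (by omega)
    · simpa [Config.setReg, hpc] using f₂
    · simp [exec, Config.setReg, hpc]
    · simpa using f₃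
    · simp [exec]
  | succ n IH =>
    have b₁ : ((k : ℤ) - extent M N b).natAbs ≤ B := by omega
    have e₁ : exec σ (.sub 2 (r + 8) (extentReg b)) =
        some (σ.setReg 2 ((k : ℤ) - extent M N b)) := by
      simp only [exec, hrep.var, hk, hrep.extentReg]
    have h₁ := hb.setReg b₁ 2
    have r₁ := hrep.setAux ((k : ℤ) - extent M N b)
    have hbody := ih _ s { σ.setReg 2 ((k : ℤ) - extent M N b) with pc := l + 4 } ⟨h₁.1, h₁.2⟩
      (r₁.setPc _) rfl h
    have := (Leads.step (I := .jumpNeg 2 (l + 4)) h₁ (by simpa [Config.setReg, hpc] using f₂)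
      (by simp [exec, Config.setReg]; omega) hbody).step hb (by rw [hpc]; exact f₁) e₁
    refine (this.bind (T' := n * (c.time M N + 5) + 3 + 3) (Q' := Q)
      (l' := l + c.size + 7) ?_).mono_time (by rw [add_mul]; omega)
    rintro s' σ' hb' hpc' hrep' ⟨hk', hit⟩
    have b₂ : (1 : ℤ).natAbs ≤ B := by simpa using hB1
    have b₃ : ((k : ℤ) + 1).natAbs ≤ B := by omega
    have h₂ := hb'.setReg b₂ 2
    have r₂ := hrep'.setAux 1
    have h₃ := h₂.setReg b₃ (r + 8)
    have r₃ := r₂.setVar r ((k : ℤ) + 1)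
    refine Leads.step (T := _ + 2) (I := .const 2 1) (σ₁ := σ'.setReg 2 1) hb' ?_ rfl
      (Leads.step (T := _ + 1) (I := .add (r + 8) (r + 8) 2)
      (σ₁ := (σ'.setReg 2 1).setReg (r + 8) ((k : ℤ) + 1)) h₂ ?_ ?_
      (Leads.step (I := .jump (l + 1))
        (σ₁ := { (σ'.setReg 2 1).setReg (r + 8) ((k : ℤ) + 1) with pc := l + 1 }) h₃ ?_ ?_
        (IH (k + 1) (by omega) ⟨h₃.1, h₃.2⟩ (r₃.setPc _) rfl (by simp [State.set]) hit)))
    · rw [hpc']; convert f₄ using 2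
    · simp only [Config.setReg, hpc']; convert f₅ using 2
    · simp only [exec, r₂.var, hk']
      simp [Config.setReg]
    · simp only [Config.setReg, hpc']; convert f₆ using 2
    · simp [exec]

/-- Correctness of the compiler, by induction on the statement. `5 * (M * N) ≤ B` covers the
addresses in all five arrays and, as `M` and `N` are positive, the loop counters. -/
theorem leads_of_wp (hB : 5 * (M * N) ≤ B) (hM : 0 < M) (hN : 0 < N) (c : Stmt)
    (hcode : CodeAt P l (compile c l)) (hb : σ.BoundedBy B) (hrep : Rep M N s σ)
    (hpc : σ.pc = l) (h : wp M N B c Q s) :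
    Leads M N B P σ (c.time M N) (l + c.size) Q := by
  have hMB : M ≤ M * N := Nat.le_mul_of_pos_right M hN
  have hNB : N ≤ M * N := Nat.le_mul_of_pos_left N hM
  induction c generalizing Q s σ l with
  | skip => exact .done hb hpc hrep h
  | const d z =>
    subst hpc
    exact .assign hb hcode.1 rfl h.1 hrep h.2
  | copy d a =>
    subst hpc
    exact .assign hb hcode.1 rfl (hb.1 _) hrep (by rw [hrep.var]; exact h)
  | add d a b =>
    subst hpc
    refine .assign hb hcode.1 rfl ?_ hrep ?_ <;> rw [hrep.var, hrep.var]
    exacts [h.1, h.2]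
  | sub d a b =>
    subst hpc
    refine .assign hb hcode.1 rfl ?_ hrep ?_ <;> rw [hrep.var, hrep.var]
    exacts [h.1, h.2]
  | mul d a b =>
    subst hpc
    refine .assign hb hcode.1 rfl ?_ hrep ?_ <;> rw [hrep.var, hrep.var]
    exacts [h.1, h.2]
  | dim d b =>
    subst hpc
    exact .assign hb hcode.1 rfl (hb.1 _) hrep (by rw [hrep.extentReg]; exact h)
  | load d k i j =>
    subst hpc
    obtain ⟨⟨hk, hi, hi', hj, hj'⟩, hQ⟩ := h
    obtain ⟨u, hu⟩ := Int.eq_ofNat_of_zero_le hi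
    obtain ⟨v, hv⟩ := Int.eq_ofNat_of_zero_le hj
    have hu' : u < M := by omega
    have hv' : v < N := by omega
    obtain ⟨f₁, f₂, f₃, f₄, -⟩ := hcode
    refine Leads.address (T := 1) hb hB hrep hk hu' hv' hu hv ⟨f₁, f₂, f₃, trivial⟩ ?_
    intro σ' hb' hpc' hrep' h2
    have := Leads.assign (I := .load (d + 8) 2) (d := d) (Q := Q) (P := P) hb'
      (by rw [hpc']; exact f₄) (by rw [exec, if_pos (by omega)]) (hb'.2 _) hrep'
      (by rw [h2, Int.toNat_natCast, hrep'.arr k hk u hu' v hv']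
          simpa [hu, hv] using hQ)
    rwa [hpc'] at this
  | loadLin d p =>
    subst hpc
    obtain ⟨⟨hp, hp'⟩, hQ⟩ := h
    refine .assign hb hcode.1 (by rw [exec, if_pos (by rw [hrep.var]; exact hp)]) (hb.2 _) hrep ?_
    obtain ⟨u, hu⟩ := Int.eq_ofNat_of_zero_le hp
    have hu' : u < N * M := by rw [hu] at hp'; rw [mul_comm]; exact_mod_cast hp'
    have hdiv : u / N < M := Nat.div_lt_of_lt_mul hu'
    -- Array 0 has base address 0, so the linear index is itself the address.
    have := hrep.arr 0 (by omega) (u / N) hdiv (u % N) (Nat.mod_lt _ hN)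
    rw [zero_mul, zero_add, mul_comm, Nat.div_add_mod] at this
    rw [hrep.var, hu, Int.toNat_natCast, this]
    simpa [hu] using hQ
  | store k i j a =>
    subst hpc
    obtain ⟨⟨hk, hi, hi', hj, hj'⟩, hQ⟩ := h
    obtain ⟨u, hu⟩ := Int.eq_ofNat_of_zero_le hi
    obtain ⟨v, hv⟩ := Int.eq_ofNat_of_zero_le hj
    have hu' : u < M := by omega
    have hv' : v < N := by omega
    obtain ⟨f₁, f₂, f₃, f₄, -⟩ := hcode
    refine Leads.address (T := 1) hb hB hrep hk hu' hv' hu hv ⟨f₁, f₂, f₃, trivial⟩ ?_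
    intro σ' hb' hpc' hrep' h2
    refine Leads.step (T := 0) (I := .store 2 (a + 8)) hb' (by rw [hpc']; exact f₄)
      (by rw [exec, if_pos (by omega)]) ?_
    rw [h2, Int.toNat_natCast, hrep'.var]
    refine .done ⟨hb'.1, fun x => ?_⟩ (by rw [hpc']; rfl) (hrep'.setMem hu' hv' _ _) ?_
    · dsimp only
      by_cases hx : x = k * (M * N) + u * N + v
      · subst hx
        rw [Function.update_self, ← hrep'.var]
        exact hb'.1 _
      · rw [Function.update_of_ne hx]
        exact hb'.2 _
    · simpa [hu, hv] using hQ
  | seq c c' ih ih' =>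
    rw [compile, codeAt_append, length_compile] at hcode
    have := (ih hcode.1 hb hrep hpc h).bind fun s' σ' hb' hpc' hrep' hQ' =>
      ih' hcode.2 hb' hrep' hpc' hQ'
    rwa [add_assoc] at this
  | ifNeg a c c' ih ih' =>
    simp only [compile, CodeAt, codeAt_append, length_compile] at hcode
    obtain ⟨f₁, f₂, f₃, f₄⟩ := hcode
    rw [show l + 1 + c'.size + 1 = l + c'.size + 2 by omega] at f₄
    by_cases ha : s.var a < 0
    · have hn : exec σ (.jumpNeg (a + 8) (l + c'.size + 2)) =
          some { σ with pc := l + c'.size + 2 } := by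
        simp [exec, hrep.var, ha]
      have := (ih f₄ (σ := { σ with pc := l + c'.size + 2 }) ⟨hb.1, hb.2⟩ (hrep.setPc _) rfl
        (h.1 ha)).step hb (by rw [hpc]; exact f₁) hn
      rw [Stmt.size, show l + (c.size + c'.size + 2) = l + c'.size + 2 + c.size by omega]
      exact this.mono_time (by rw [Stmt.time]; omega)
    · have hn : exec σ (.jumpNeg (a + 8) (l + c'.size + 2)) = some { σ with pc := l + 1 } := by
        simp [exec, hrep.var, ha, hpc]
      have := (ih' f₂ (σ := { σ with pc := l + 1 }) ⟨hb.1, hb.2⟩ (hrep.setPc _) rfl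
        (h.2 (by omega))).step hb (by rw [hpc]; exact f₁) hn
      refine (this.bind (T' := 1) (Q' := Q) fun s' σ' hb' hpc' hrep' hQ' =>
        Leads.step (I := .jump (l + c'.size + c.size + 2)) (T := 0) hb' ?_ rfl
          (.done ⟨hb'.1, hb'.2⟩ ?_ (hrep'.setPc _) hQ')).mono_time (by rw [Stmt.time]; omega)
      · rw [hpc']; exact f₃
      · simp only [Stmt.size]; omega
  | ifZero a c c' ih ih' =>
    simp only [compile, CodeAt, codeAt_append, length_compile] at hcode
    obtain ⟨f₁, f₂, f₃, f₄⟩ := hcode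
    rw [show l + 1 + c'.size + 1 = l + c'.size + 2 by omega] at f₄
    by_cases ha : s.var a = 0
    · have hn : exec σ (.jumpZero (a + 8) (l + c'.size + 2)) =
          some { σ with pc := l + c'.size + 2 } := by
        simp [exec, hrep.var, ha]
      have := (ih f₄ (σ := { σ with pc := l + c'.size + 2 }) ⟨hb.1, hb.2⟩ (hrep.setPc _) rfl
        (h.1 ha)).step hb (by rw [hpc]; exact f₁) hn
      rw [Stmt.size, show l + (c.size + c'.size + 2) = l + c'.size + 2 + c.size by omega]
      exact this.mono_time (by rw [Stmt.time]; omega)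
    · have hn : exec σ (.jumpZero (a + 8) (l + c'.size + 2)) = some { σ with pc := l + 1 } := by
        simp [exec, hrep.var, ha, hpc]
      have := (ih' f₂ (σ := { σ with pc := l + 1 }) ⟨hb.1, hb.2⟩ (hrep.setPc _) rfl
        (h.2 ha)).step hb (by rw [hpc]; exact f₁) hn
      refine (this.bind (T' := 1) (Q' := Q) fun s' σ' hb' hpc' hrep' hQ' =>
        Leads.step (I := .jump (l + c'.size + c.size + 2)) (T := 0) hb' ?_ rfl
          (.done ⟨hb'.1, hb'.2⟩ ?_ (hrep'.setPc _) hQ')).mono_time (by rw [Stmt.time]; omega)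
      · rw [hpc']; exact f₃
      · simp only [Stmt.size]; omega
  | loop r b c ih =>
    have hE : extent M N b ≤ B := by cases b <;> simp only [extent] <;> simp <;> omega
    have hbody := hcode
    simp only [compile, CodeAt, codeAt_append] at hbody
    have := leads_of_wpIter hE (by omega) hcode
      (fun Q s σ hb hrep hpc h => ih hbody.2.2.2.2.1 hb hrep hpc h) (extent M N b) 0 (by simp)
      (hb.setReg (z := 0) (by simp) (r + 8)) (hrep.setVar r 0)
      (by simp [Config.setReg, hpc]) (by simp [State.set]) h
    exact this.step hb (by rw [hpc]; exact hbody.1) rfl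

end ArrayProgram

/-! ### Frame property and loop rule. -/

namespace ArrayProgram

/-- The variables that a statement may change. -/
def Stmt.writes : Stmt → List ℕ
  | .const d _ | .copy d _ | .add d _ _ | .sub d _ _ | .mul d _ _ | .dim d _
  | .load d _ _ _ | .loadLin d _ => [d]
  | .seq c c' | .ifNeg _ c c' | .ifZero _ c c' => c.writes ++ c'.writes
  | .loop r _ c => r :: c.writes
  | _ => []

/-- The arrays that a statement may change. -/
def Stmt.stores : Stmt → List ℕ
  | .store k _ _ _ => [k]
  | .seq c c' | .ifNeg _ c c' | .ifZero _ c c' => c.stores ++ c'.stores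
  | .loop _ _ c => c.stores
  | _ => []

/-- The states `s` and `s'` agree in everything that `c` cannot change. -/
structure Frame (c : Stmt) (s s' : State) : Prop where
  var : ∀ r ∉ c.writes, s'.var r = s.var r
  arr : ∀ k ∉ c.stores, s'.arr k = s.arr k

variable {M N B : ℕ} {s s' s'' : State} {c c' : Stmt} {Q Q' : State → Prop} {r : ℕ} {b : Bool}

@[simp] theorem State.set_var (d : ℕ) (z : ℤ) :
    (s.set d z).var r = if r = d then z else s.var r := by
  simp [State.set, Function.update_apply]

@[simp] theorem State.set_arr (d : ℕ) (z : ℤ) : (s.set d z).arr = s.arr := rfl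

@[simp] theorem State.setArr_var (k i j : ℕ) (z : ℤ) : (s.setArr k i j z).var = s.var := rfl

@[simp] theorem State.setArr_arr (k i j k' i' j' : ℕ) (z : ℤ) : (s.setArr k i j z).arr k' i' j' =
    if k' = k ∧ i' = i ∧ j' = j then z else s.arr k' i' j' := rfl

theorem Frame.refl (c : Stmt) (s : State) : Frame c s s := ⟨fun _ _ => rfl, fun _ _ => rfl⟩

theorem Frame.trans (h : Frame c s s') (h' : Frame c s' s'') : Frame c s s'' :=
  ⟨fun r hr => (h'.var r hr).trans (h.var r hr), fun k hk => (h'.arr k hk).trans (h.arr k hk)⟩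

theorem Frame.mono (h : Frame c s s') (hw : c.writes ⊆ c'.writes) (hs : c.stores ⊆ c'.stores) :
    Frame c' s s' :=
  ⟨fun r hr => h.var r fun h => hr (hw h), fun k hk => h.arr k fun h => hk (hs h)⟩

theorem Frame.set (h : Frame c s s') {d : ℕ} (hd : d ∈ c.writes) (z : ℤ) :
    Frame c s (s'.set d z) :=
  ⟨fun r hr => by rw [State.set_var, if_neg (by rintro rfl; exact hr hd)]; exact h.var r hr, h.arr⟩

theorem wpIter_mono {body : (State → Prop) → State → Prop}
    (hbody : ∀ (Q Q' : State → Prop) s, (∀ s', Q s' → Q' s') → body Q s → body Q' s)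
    (hQ : ∀ s, Q s → Q' s) (n k : ℕ) (h : wpIter body r Q n k s) : wpIter body r Q' n k s := by
  induction n generalizing k s with
  | zero => exact hQ _ h
  | succ n ih => exact hbody _ _ _ (fun s' h' => ⟨h'.1, ih _ h'.2⟩) h

theorem wp_mono (hQ : ∀ s, Q s → Q' s) (h : wp M N B c Q s) : wp M N B c Q' s := by
  induction c generalizing Q Q' s with
  | skip | copy | dim => exact hQ _ h
  | const | add | sub | mul | load | loadLin | store => exact ⟨h.1, hQ _ h.2⟩
  | seq c c' ih ih' => exact ih (fun s => ih' hQ) h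
  | ifNeg a c c' ih ih' => exact ⟨fun ha => ih hQ (h.1 ha), fun ha => ih' hQ (h.2 ha)⟩
  | ifZero a c c' ih ih' => exact ⟨fun ha => ih hQ (h.1 ha), fun ha => ih' hQ (h.2 ha)⟩
  | loop r b c ih =>
    exact wpIter_mono (body := wp M N B c) (fun _ _ _ hQ h => ih hQ h) hQ _ _ h

/-- What is untouched can be read off the syntax. Specifications and invariants therefore mention
only what changes, and the rest is settled by `decide` on the lists of written names. -/
theorem wp_frame (h : wp M N B c Q s) : wp M N B c (fun s' => Q s' ∧ Frame c s s') s := by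
  induction c generalizing Q s with
  | skip => exact ⟨h, .refl _ _⟩
  | copy | dim => exact ⟨h, (Frame.refl _ _).set (by simp [Stmt.writes]) _⟩
  | const | add | sub | mul | load | loadLin =>
    exact ⟨h.1, h.2, (Frame.refl _ _).set (by simp [Stmt.writes]) _⟩
  | store k i j a =>
    refine ⟨h.1, h.2, fun _ _ => rfl, fun k' hk' => ?_⟩
    have : k' ≠ k := by simpa [Stmt.stores] using hk'
    funext i' j'
    simp [this]
  | seq c c' ih ih' =>
    refine wp_mono (c := c) ?_ (ih h)
    rintro s' ⟨h', hf⟩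
    refine wp_mono ?_ (ih' h')
    rintro s'' ⟨hQ, hf'⟩
    exact ⟨hQ, (hf.mono (by simp [Stmt.writes]) (by simp [Stmt.stores])).trans
      (hf'.mono (by simp [Stmt.writes]) (by simp [Stmt.stores]))⟩
  | ifNeg a c c' ih ih' =>
    refine ⟨fun ha => wp_mono ?_ (ih (h.1 ha)), fun ha => wp_mono ?_ (ih' (h.2 ha))⟩ <;>
    exact fun s' h' => ⟨h'.1, h'.2.mono (by simp [Stmt.writes]) (by simp [Stmt.stores])⟩
  | ifZero a c c' ih ih' =>
    refine ⟨fun ha => wp_mono ?_ (ih (h.1 ha)), fun ha => wp_mono ?_ (ih' (h.2 ha))⟩ <;>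
    exact fun s' h' => ⟨h'.1, h'.2.mono (by simp [Stmt.writes]) (by simp [Stmt.stores])⟩
  | loop r b c ih =>
    have hr : r ∈ (Stmt.loop r b c).writes := by simp [Stmt.writes]
    have key : ∀ (n k : ℕ) (s' : State), Frame (.loop r b c) s s' →
        wpIter (wp M N B c) r Q n k s' →
        wpIter (wp M N B c) r (fun s' => Q s' ∧ Frame (.loop r b c) s s') n k s' := by
      intro n
      induction n with
      | zero => exact fun k s' hf h => ⟨h, hf⟩
      | succ n IH =>
        intro k s' hf h
        refine wp_mono ?_ (ih h)
        rintro s'' ⟨⟨hk, h''⟩, hf'⟩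
        refine ⟨hk, IH _ _ (Frame.set (hf.trans ?_) hr _) h''⟩
        exact hf'.mono (by simp [Stmt.writes]) (by simp [Stmt.stores])
    exact key _ _ _ ((Frame.refl _ _).set hr 0) h

/-- The postcondition may assume the frame property. -/
theorem wp_framed (h : wp M N B c (fun s' => Frame c s s' → Q s') s) : wp M N B c Q s :=
  wp_mono (fun _ h => h.1 h.2) (wp_frame h)

/-- The loop rule: an invariant, which may assume the frame property. -/
theorem wp_loop (Inv : ℕ → State → Prop) (hr : r ∉ c.writes) (start : Inv 0 (s.set r 0))
    (step : ∀ k < extent M N b, ∀ s', Frame (.loop r b c) s s' → s'.var r = k → Inv k s' →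
      wp M N B c (fun s'' => Inv (k + 1) (s''.set r ((k : ℤ) + 1))) s')
    (post : ∀ s', Frame (.loop r b c) s s' → Inv (extent M N b) s' → Q s') :
    wp M N B (.loop r b c) Q s := by
  have hr' : r ∈ (Stmt.loop r b c).writes := by simp [Stmt.writes]
  have key : ∀ (n k : ℕ) (s' : State), k + n = extent M N b → Frame (.loop r b c) s s' →
      s'.var r = k → Inv k s' → wpIter (wp M N B c) r Q n k s' := by
    intro n
    induction n with
    | zero =>
      rintro k s' rfl hf - hI
      exact post s' hf hI
    | succ n ih =>
      intro k s' hn hf hk hI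
      refine wp_mono ?_ (wp_frame (step k (by omega) s' hf hk hI))
      rintro s'' ⟨h'', hf'⟩
      refine ⟨by rw [hf'.var r hr, hk], ih _ _ (by omega) (Frame.set (hf.trans ?_) hr' _)
        (by simp) h''⟩
      exact hf'.mono (by simp [Stmt.writes]) (by simp [Stmt.stores])
  exact key _ 0 _ (by simp) ((Frame.refl _ _).set hr' 0) (by simp) start

theorem wp_seq (h : wp M N B c (wp M N B c' Q) s) : wp M N B (c ;; c') Q s := h

theorem wp_dim {d : ℕ} (h : Q (s.set d (extent M N b))) : wp M N B (.dim d b) Q s := h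

end ArrayProgram

/-! ### Normalising the rows. -/

namespace ArrayProgram
open Stmt
variable {M N B : ℕ} {s : State} {Q : State → Prop}

/-- Variable 8 := minimum of row `i` of array 1, where `i` is the value of variable 1. -/
def rowMin : Stmt :=
  load 8 1 1 0 ;; loop 2 false (load 3 1 1 2 ;; sub 4 3 8 ;; ifNeg 4 (copy 8 3) skip)

theorem wp_rowMin {i L : ℕ} (h0 : s.var 0 = 0) (h1 : s.var 1 = i) (hi : i < M) (hN : 0 < N)
    (hL : ∀ j < N, (s.arr 1 i j).natAbs ≤ L) (hB : 2 * L ≤ B)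
    (hQ : ∀ s', Frame rowMin s s' → (∀ j < N, s'.var 8 ≤ s.arr 1 i j) →
      (∃ j < N, s'.var 8 = s.arr 1 i j) → Q s') : wp M N B rowMin Q s := by
  refine wp_framed ?_
  refine wp_seq ⟨by simp [h0, h1, hi, hN], ?_⟩
  refine wp_loop (fun k s' => (∀ j < k, s'.var 8 ≤ s.arr 1 i j) ∧
    (∃ j < N, s'.var 8 = s.arr 1 i j)) (by decide) ?_ ?_ ?_
  · exact ⟨by simp, 0, hN, by simp [h0, h1]⟩
  · rintro j hj s' hf h2 ⟨hle, j', hj', he⟩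
    have e1 : s'.var 1 = i := by rw [hf.var 1 (by decide)]; simpa using h1
    have ea : s'.arr 1 = s.arr 1 := by rw [hf.arr 1 (by decide)]; rfl
    replace hj : j < N := hj
    have := hL j hj
    have := hL j' hj'
    simp [wp, e1, h2, ea, hi, hj]
    refine ⟨by omega, fun hlt => ⟨fun x hx => ?_, j, hj, rfl⟩,
      fun hge => ⟨fun x hx => ?_, j', hj', he⟩⟩
    · rcases hx.lt_or_eq with hx | rfl
      · have := hle x hx; omega
      · exact le_rfl
    · rcases hx.lt_or_eq with hx | rfl
      · exact hle x hx
      · omega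
  · rintro s' - ⟨hle, he⟩ hf
    exact hQ s' hf hle he

/-- The row `v` arises from `w` by subtracting the minimum. -/
def NormRow (N : ℕ) (w v : ℕ → ℤ) : Prop :=
  (∃ lo, ∀ j < N, v j = w j - lo) ∧ (∀ j < N, 0 ≤ v j) ∧ ∃ j < N, v j = 0

/-- Subtract from each row of array 1 its minimum. -/
def normalise : Stmt :=
  loop 1 true (rowMin ;; loop 2 false (load 3 1 1 2 ;; sub 3 3 8 ;; store 1 1 2 3))

theorem wp_normalise {L : ℕ} (h0 : s.var 0 = 0) (hN : 0 < N)
    (hL : ∀ i < M, ∀ j < N, (s.arr 1 i j).natAbs ≤ L) (hB : 2 * L ≤ B)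
    (hQ : ∀ s', Frame normalise s s' → (∀ i < M, NormRow N (s.arr 1 i) (s'.arr 1 i)) → Q s') :
    wp M N B normalise Q s := by
  refine wp_framed ?_
  -- Rows from `i` on are still the original ones, so the minimum computed next is that of the
  -- original row.
  refine wp_loop (fun i s' => (∀ i' < i, NormRow N (s.arr 1 i') (s'.arr 1 i')) ∧
    ∀ i' ≥ i, s'.arr 1 i' = s.arr 1 i') (by decide) ?_ ?_ ?_
  · exact ⟨by simp, by simp⟩
  · rintro i hi s' hf h1 ⟨hdone, htodo⟩
    replace hi : i < M := hi
    have e0 : s'.var 0 = 0 := by rw [hf.var 0 (by decide), h0]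
    have ea : s'.arr 1 i = s.arr 1 i := htodo i le_rfl
    refine wp_seq (wp_rowMin (L := L) e0 h1 hi hN (by rw [ea]; exact hL i hi) hB ?_)
    rintro s₁ hf₁ hle ⟨j₀, hj₀, hlo⟩
    have e1 : s₁.var 1 = i := by rw [hf₁.var 1 (by decide), h1]
    have ea₁ : s₁.arr 1 = s'.arr 1 := hf₁.arr 1 (by decide)
    rw [ea] at hle hlo
    refine wp_loop (fun j s₂ => (∀ j' < j, s₂.arr 1 i j' = s.arr 1 i j' - s₁.var 8) ∧
      (∀ j' ≥ j, s₂.arr 1 i j' = s.arr 1 i j') ∧ ∀ i' ≠ i, s₂.arr 1 i' = s'.arr 1 i')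
      (by decide) ?_ ?_ ?_
    · exact ⟨by simp, by simp [ea₁, ea], by simp [ea₁]⟩
    · rintro j hj s₂ hf₂ h2 ⟨hd, ht, ho⟩
      replace hj : j < N := hj
      have e1' : s₂.var 1 = i := by rw [hf₂.var 1 (by decide), e1]
      have e8 : s₂.var 8 = s₁.var 8 := hf₂.var 8 (by decide)
      have := hL i hi j hj
      have := hL i hi j₀ hj₀
      simp [wp, e1', h2, e8, hi, hj, ht j le_rfl]
      refine ⟨by omega, fun j' hj' => ?_, fun j' hj' => ?_, fun i' hi' => ?_⟩
      · split_ifs with h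
        · rw [h]
        · exact hd j' (by omega)
      · rw [if_neg (by omega), ht j' (by omega)]
      · funext j'
        simp [hi', ho i' hi']
    · rintro s₂ hf₂ ⟨hd, -, ho⟩
      refine ⟨fun i' hi' => ?_, fun i' hi' => ?_⟩
      · rw [State.set_arr]
        rcases Nat.lt_succ_iff_lt_or_eq.1 hi' with hi' | rfl
        · rw [ho i' hi'.ne]
          exact hdone i' hi'
        · refine ⟨⟨_, hd⟩, fun j hj => ?_, j₀, hj₀, ?_⟩
          · rw [hd j hj]; have := hle j hj; omega
          · rw [hd j₀ hj₀, hlo, sub_self]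
      · rw [State.set_arr, ho i' (by omega), htodo i' (by omega)]
  · rintro s' - ⟨h, -⟩ hf
    exact hQ s' hf h

end ArrayProgram

/-! ### Priorities, the threshold, and the column offsets. -/

namespace ArrayProgram
open Stmt
variable {M N B : ℕ} {s : State} {Q : State → Prop}

/-- Number of zeros among the first `N` entries of `v`. -/
def zeros (N : ℕ) (v : ℕ → ℤ) : ℕ := ((Finset.range N).filter fun j => v j = 0).card

theorem zeros_le (N : ℕ) (v : ℕ → ℤ) : zeros N v ≤ N :=
  (Finset.card_filter_le _ _).trans (Finset.card_range N).le

theorem zeros_succ (N : ℕ) (v : ℕ → ℤ) :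
    zeros (N + 1) v = zeros N v + if v N = 0 then 1 else 0 := by
  simp only [zeros, Finset.range_add_one, Finset.filter_insert]
  split_ifs with h
  · rw [Finset.card_insert_of_notMem (by simp)]
  · rfl

/-- Variable 8 := number of zeros of the row, variable 9 := 1 if the row has an entry that is at
least 2, and 0 otherwise. -/
def countRow : Stmt :=
  const 8 0 ;; const 9 0 ;; loop 2 false (load 3 1 1 2 ;; ifZero 3 (const 4 1 ;; add 8 8 4)
    (const 4 2 ;; sub 4 3 4 ;; ifNeg 4 skip (const 9 1)))

theorem wp_countRow {i L : ℕ} (h1 : s.var 1 = i) (hi : i < M)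
    (hL : ∀ j < N, (s.arr 1 i j).natAbs ≤ L) (hB : L + 2 ≤ B) (hNB : N + 2 ≤ B)
    (hQ : ∀ s', Frame countRow s s' → s'.var 8 = zeros N (s.arr 1 i) →
      (s'.var 9 = 0 ∧ (∀ j < N, s.arr 1 i j < 2) ∨ s'.var 9 = 1 ∧ ∃ j < N, 2 ≤ s.arr 1 i j) →
      Q s') : wp M N B countRow Q s := by
  refine wp_framed ?_
  refine wp_seq ⟨by simp, wp_seq ⟨by simp, ?_⟩⟩
  refine wp_loop (fun k s' => s'.var 8 = zeros k (s.arr 1 i) ∧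
    (s'.var 9 = 0 ∧ (∀ j < k, s.arr 1 i j < 2) ∨ s'.var 9 = 1 ∧ ∃ j < N, 2 ≤ s.arr 1 i j))
    (by decide) ?_ ?_ ?_
  · simp [zeros]
  · rintro j hj s' hf h2 ⟨h8, h9⟩
    replace hj : j < N := hj
    have e1 : s'.var 1 = i := by rw [hf.var 1 (by decide)]; simpa using h1
    have ea : s'.arr 1 = s.arr 1 := by rw [hf.arr 1 (by decide)]; rfl
    have := hL j hj
    have := zeros_le j (s.arr 1 i)
    simp [wp, e1, h2, ea, hi, hj, h8, zeros_succ]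
    refine ⟨fun hz => ⟨by omega, by omega, by simp [hz], ?_⟩,
      fun hz => ⟨by omega, by omega, fun hlt => ⟨hz, ?_⟩, fun hge => ⟨by omega, hz, j, hj, hge⟩⟩⟩
    · refine h9.imp (fun h => ⟨h.1, fun x hx => ?_⟩) id
      rcases hx.lt_or_eq with hx | rfl
      · have := h.2 x hx; omega
      · omega
    · refine h9.imp (fun h => ⟨h.1, fun x hx => ?_⟩) id
      rcases hx.lt_or_eq with hx | rfl
      · have := h.2 x hx; omega
      · omega
  · rintro s' - ⟨h8, h9⟩ hf
    exact hQ s' hf h8 h9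

/-- `p` is the priority of a row: `N + 1` minus the number of zeros, or `N + 1` if the row has an
entry that is at least 2. -/
def IsPriority (N : ℕ) (v : ℕ → ℤ) (p : ℤ) : Prop :=
  (∀ j < N, v j < 2) ∧ p = N + 1 - zeros N v ∨ (∃ j < N, 2 ≤ v j) ∧ p = N + 1

theorem IsPriority.bounds {v : ℕ → ℤ} {p : ℤ} (h : IsPriority N v p) : 1 ≤ p ∧ p ≤ N + 1 := by
  have := zeros_le N v
  rcases h with ⟨-, rfl⟩ | ⟨-, rfl⟩ <;> omega

/-- Raise the entries of the first row of array 4 to the value of variable 12, in those columns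
where the current row of array 1 is zero. -/
def raise : Stmt :=
  loop 2 false (load 3 1 1 2 ;;
    ifZero 3 (load 4 4 0 2 ;; sub 13 4 12 ;; ifNeg 13 (store 4 0 2 12) skip) skip)

theorem wp_raise {i : ℕ} (h0 : s.var 0 = 0) (h1 : s.var 1 = i) (hi : i < M)
    (hp : 0 ≤ s.var 12 ∧ s.var 12 ≤ N + 1) (hg : ∀ j < N, 0 ≤ s.arr 4 0 j ∧ s.arr 4 0 j ≤ N + 1)
    (hNB : N + 1 ≤ B)
    (hQ : ∀ s', Frame raise s s' → (∀ j < N, s'.arr 4 0 j =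
      if s.arr 1 i j = 0 then max (s.arr 4 0 j) (s.var 12) else s.arr 4 0 j) → Q s') :
    wp M N B raise Q s := by
  refine wp_framed ?_
  refine wp_loop (fun k s' => ∀ j < N, s'.arr 4 0 j = if j < k ∧ s.arr 1 i j = 0 then
    max (s.arr 4 0 j) (s.var 12) else s.arr 4 0 j) (by decide) ?_ ?_ ?_
  · simp
  · rintro j hj s' hf h2 h
    replace hj : j < N := hj
    have e0 : s'.var 0 = 0 := by rw [hf.var 0 (by decide), h0]
    have e1 : s'.var 1 = i := by rw [hf.var 1 (by decide), h1]
    have e12 : s'.var 12 = s.var 12 := by rw [hf.var 12 (by decide)]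
    have ea : s'.arr 1 = s.arr 1 := hf.arr 1 (by decide)
    have hM : 0 < M := by omega
    have e4 : s'.arr 4 0 j = s.arr 4 0 j := by simp [h j hj]
    have := hg j hj
    simp [wp, e0, e1, e12, h2, ea, hi, hj, hM, e4]
    refine ⟨fun hz => ⟨by omega, fun hlt x hx => ?_, fun hge x hx => ?_⟩, fun hz x hx => ?_⟩
    · by_cases hxj : x = j
      · subst hxj; simp [hz]; omega
      · simp [hxj, h x hx, show x ≤ j ↔ x < j by omega]
    · by_cases hxj : x = j
      · subst hxj; simp [hz, e4]; omega
      · simp [h x hx, show x ≤ j ↔ x < j by omega]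
    · by_cases hxj : x = j
      · subst hxj; simp [hz, e4]
      · simp [h x hx, show x ≤ j ↔ x < j by omega]
  · intro s' hf' h hf
    refine hQ s' hf fun j hj => ?_
    rw [h j hj]
    simp [extent, hj]

/-- Store the priorities of the rows of array 1 in the first column of array 2, and for each column
the maximal priority of a row with a zero there in the first row of array 4. -/
def priorities : Stmt :=
  loop 1 true (countRow ;; dim 12 false ;; const 4 1 ;; add 12 12 4 ;;
    ifZero 9 (sub 12 12 8) skip ;; store 2 1 0 12 ;; raise)

/-- `g` is the maximum of the priorities `pr i` over the rows `i < M` with `V i = 0`, or zero. -/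
def IsMaxPriority (M : ℕ) (V : ℕ → ℤ) (pr : ℕ → ℤ) (g : ℤ) : Prop :=
  (∀ i < M, V i = 0 → pr i ≤ g) ∧ (g = 0 ∨ ∃ i < M, V i = 0 ∧ g = pr i)

/-- Priorities are at least 1, so the initial value 0 in array 4 survives exactly in the columns
where no row vanishes. -/
theorem wp_priorities {L : ℕ} (h0 : s.var 0 = 0) (hN : 0 < N)
    (hL : ∀ i < M, ∀ j < N, (s.arr 1 i j).natAbs ≤ L) (hB : L + 2 ≤ B) (hNB : N + 2 ≤ B)
    (h4 : ∀ j < N, s.arr 4 0 j = 0)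
    (hQ : ∀ s', Frame priorities s s' →
      (∀ i < M, IsPriority N (s.arr 1 i) (s'.arr 2 i 0)) →
      (∀ j < N, 0 ≤ s'.arr 4 0 j ∧ s'.arr 4 0 j ≤ N + 1) →
      (∀ j < N, IsMaxPriority M (fun i => s.arr 1 i j) (fun i => s'.arr 2 i 0) (s'.arr 4 0 j)) →
      Q s') : wp M N B priorities Q s := by
  refine wp_framed ?_
  refine wp_loop (fun k s' => (∀ i < k, IsPriority N (s.arr 1 i) (s'.arr 2 i 0)) ∧
      (∀ j < N, 0 ≤ s'.arr 4 0 j ∧ s'.arr 4 0 j ≤ N + 1) ∧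
      (∀ j < N, IsMaxPriority k (fun i => s.arr 1 i j) (fun i => s'.arr 2 i 0) (s'.arr 4 0 j)))
      (by decide) ?_ ?_ ?_
  · refine ⟨by simp, fun j hj => ?_, fun j hj => ⟨by simp, Or.inl ?_⟩⟩ <;> simp [h4 j hj]
    omega
  · rintro i hi s' hf h1 ⟨hp, hg, hmax⟩
    replace hi : i < M := hi
    have e0 : s'.var 0 = 0 := by rw [hf.var 0 (by decide), h0]
    have ea : s'.arr 1 = s.arr 1 := hf.arr 1 (by decide)
    refine wp_seq (wp_countRow (L := L) h1 hi (by rw [ea]; exact hL i hi) hB hNB ?_)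
    rw [ea]
    intro s₁ hf₁ h8 h9
    have e1 : s₁.var 1 = i := by rw [hf₁.var 1 (by decide), h1]
    have e0₁ : s₁.var 0 = 0 := by rw [hf₁.var 0 (by decide), e0]
    have ea₁ : s₁.arr = s'.arr := by
      funext k; exact hf₁.arr k (by simp [countRow, Stmt.stores])
    have hz := zeros_le N (s.arr 1 i)
    -- Both outcomes of the test on variable 9 continue in the same way; the continuation is treated
    -- once, for an arbitrary priority `p` of the row.
    suffices key : ∀ (s₂ : State) (p : ℤ), IsPriority N (s.arr 1 i) p → s₂.var 12 = p →
        s₂.var 0 = 0 → s₂.var 1 = i → s₂.arr = s'.arr →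
        wp M N B (store 2 1 0 12 ;; raise) (fun s'' =>
          (∀ i' < i + 1, IsPriority N (s.arr 1 i') (s''.arr 2 i' 0)) ∧
          (∀ j < N, 0 ≤ s''.arr 4 0 j ∧ s''.arr 4 0 j ≤ N + 1) ∧
          (∀ j < N, IsMaxPriority (i + 1) (fun i' => s.arr 1 i' j) (fun i' => s''.arr 2 i' 0)
            (s''.arr 4 0 j))) s₂ by
      have hpr : ∀ p : ℤ, (s₁.var 9 = 0 ∧ p = N + 1 - s₁.var 8 ∨ s₁.var 9 ≠ 0 ∧ p = N + 1) →
          IsPriority N (s.arr 1 i) p := by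
        rintro p (⟨h9', rfl⟩ | ⟨h9', rfl⟩)
        · rw [h8]
          exact Or.inl ⟨(h9.resolve_right fun h => by omega).2, rfl⟩
        · exact Or.inr ⟨(h9.resolve_left fun h => by omega).2, rfl⟩
      refine wp_seq (wp_dim (wp_seq ⟨by simp; omega, wp_seq ⟨?_, wp_seq ⟨fun h9' => ⟨?_, ?_⟩,
        fun h9' => ?_⟩⟩⟩))
      · simp [extent]; omega
      · simp [extent]; omega
      · replace h9' : s₁.var 9 = 0 := by simpa using h9'
        refine key _ (N + 1 - s₁.var 8) (hpr _ (Or.inl ⟨h9', rfl⟩)) ?_ ?_ ?_ ?_ <;>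
          simp [e0₁, e1, ea₁, extent]
      · replace h9' : s₁.var 9 ≠ 0 := by simpa using h9'
        refine key _ (N + 1) (hpr _ (Or.inr ⟨h9', rfl⟩)) ?_ ?_ ?_ ?_ <;>
          simp [e0₁, e1, ea₁, extent]
    intro s₂ p hpr h12 e0₂ e1₂ ea₂
    have hpb := hpr.bounds
    refine wp_seq ⟨by simp [e0₂, e1₂, hi, hN], ?_⟩
    refine wp_raise (i := i) (by simpa using e0₂) (by simpa using e1₂) hi (by simp; omega)
      (fun j hj => ?_) (by omega) ?_
    · simpa [ea₂] using hg j hj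
    intro s₃ hf₃ h₃
    have h2' : ∀ i', s₃.arr 2 i' 0 = if i' = i then p else s'.arr 2 i' 0 := by
      intro i'
      rw [hf₃.arr 2 (by decide)]
      simp [e0₂, e1₂, h12, ea₂]
    replace h₃ : ∀ j < N, s₃.arr 4 0 j =
        if s.arr 1 i j = 0 then max (s'.arr 4 0 j) p else s'.arr 4 0 j := by
      intro j hj
      rw [h₃ j hj]
      simp [ea₂, ea, h12]
    simp only [h2']
    refine ⟨fun i' hi' => ?_, fun j hj => ?_, fun j hj => ⟨fun i' hi' hv => ?_, ?_⟩⟩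
    · split_ifs with h
      · rw [h]; exact hpr
      · exact hp i' (by omega)
    · have := hg j hj
      rw [h₃ j hj]
      split_ifs <;> omega
    · rw [h₃ j hj]
      have := (hmax j hj).1
      rcases Nat.lt_succ_iff_lt_or_eq.1 hi' with hi' | rfl
      · have := this i' hi' hv
        dsimp only at this
        simp only [hi'.ne, if_false]
        split_ifs <;> omega
      · rw [if_pos hv]
        simp
    · rw [h₃ j hj]
      have hold : s'.arr 4 0 j = 0 ∨ ∃ i' < i + 1, s.arr 1 i' j = 0 ∧
          s'.arr 4 0 j = if i' = i then p else s'.arr 2 i' 0 := by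
        refine (hmax j hj).2.imp id ?_
        rintro ⟨i', hi', hv, he⟩
        exact ⟨i', by omega, hv, by simpa [hi'.ne] using he⟩
      split_ifs with hv
      · rcases max_choice (s'.arr 4 0 j) p with hm | hm <;> rw [hm]
        · exact hold
        · exact Or.inr ⟨i, by omega, hv, by simp⟩
      · exact hold
  · rintro s' - ⟨hp, hg, hmax⟩ hf
    exact hQ s' hf hp hg hmax

/-- Store for each row the maximum of array 4 over the columns with a nonzero entry in the first
column of array 3. -/
def rowMaxima : Stmt :=
  loop 1 true (const 8 0 ;; loop 2 false (load 3 1 1 2 ;;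
    ifZero 3 skip (load 12 4 0 2 ;; sub 4 8 12 ;; ifNeg 4 (copy 8 12) skip)) ;; store 3 1 0 8)

/-- `h` is the maximum of `g` over the columns with a nonzero entry, or zero. -/
def IsRowMax (N : ℕ) (v g : ℕ → ℤ) (h : ℤ) : Prop :=
  (∀ j < N, v j ≠ 0 → g j ≤ h) ∧ (h = 0 ∨ ∃ j < N, v j ≠ 0 ∧ h = g j)

theorem wp_rowMaxima (h0 : s.var 0 = 0) (hN : 0 < N) (hNB : N + 1 ≤ B)
    (hg : ∀ j < N, 0 ≤ s.arr 4 0 j ∧ s.arr 4 0 j ≤ N + 1)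
    (hQ : ∀ s', Frame rowMaxima s s' →
      (∀ i < M, IsRowMax N (s.arr 1 i) (s.arr 4 0) (s'.arr 3 i 0)) → Q s') :
    wp M N B rowMaxima Q s := by
  refine wp_framed ?_
  refine wp_loop (fun k s' => ∀ i < k, IsRowMax N (s.arr 1 i) (s.arr 4 0) (s'.arr 3 i 0))
    (by decide) ?_ ?_ ?_
  · simp
  · intro i hi s' hf h1 h
    replace hi : i < M := hi
    have hM : 0 < M := by omega
    have e0 : s'.var 0 = 0 := by rw [hf.var 0 (by decide), h0]
    have ea : s'.arr 1 = s.arr 1 := hf.arr 1 (by decide)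
    have eg : s'.arr 4 = s.arr 4 := hf.arr 4 (by decide)
    refine wp_seq ⟨by simp, wp_seq ?_⟩
    refine wp_loop (fun k s₁ => IsRowMax k (s.arr 1 i) (s.arr 4 0) (s₁.var 8) ∧
      0 ≤ s₁.var 8 ∧ s₁.var 8 ≤ N + 1) (by decide) ?_ ?_ ?_
    · simp [IsRowMax]; omega
    · rintro j hj s₁ hf₁ h2 ⟨⟨hle, hex⟩, hb, hb'⟩
      replace hj : j < N := hj
      have e0₁ : s₁.var 0 = 0 := by rw [hf₁.var 0 (by decide)]; simpa using e0
      have e1₁ : s₁.var 1 = i := by rw [hf₁.var 1 (by decide)]; simpa using h1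
      have ea₁ : s₁.arr 1 = s.arr 1 := by rw [hf₁.arr 1 (by decide)]; simpa using ea
      have eg₁ : s₁.arr 4 = s.arr 4 := by rw [hf₁.arr 4 (by decide)]; simpa using eg
      have := hg j hj
      have hold : s₁.var 8 = 0 ∨ ∃ j' < j + 1, s.arr 1 i j' ≠ 0 ∧ s₁.var 8 = s.arr 4 0 j' :=
        hex.imp id fun ⟨j', hj', h⟩ => ⟨j', by omega, h⟩
      simp only [wp, State.set_var, State.set_arr, e0₁, e1₁, ea₁, eg₁, h2, IsRowMax]
      simp [hi, hM, hj, -Order.lt_add_one_iff]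
      refine ⟨fun hz => ⟨⟨fun x hx hv => ?_, hold⟩, hb, hb'⟩, fun hz => ⟨by omega,
        fun hlt => ⟨⟨fun x hx hv => ?_, Or.inr ⟨j, by omega, hz, rfl⟩⟩, this⟩,
        fun hge => ⟨⟨fun x hx hv => ?_, hold⟩, hb, hb'⟩⟩⟩
      all_goals
        rcases Nat.lt_succ_iff_lt_or_eq.1 hx with hx | rfl
        · have := hle x hx hv
          omega
        · first
          | exact absurd hz hv
          | omega
    · rintro s₁ hf₁ ⟨hmax, -, -⟩
      have e0₁ : s₁.var 0 = 0 := by rw [hf₁.var 0 (by decide)]; simpa using e0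
      have e1₁ : s₁.var 1 = i := by rw [hf₁.var 1 (by decide)]; simpa using h1
      have eh₁ : s₁.arr 3 = s'.arr 3 := by rw [hf₁.arr 3 (by decide)]; simp
      simp only [wp, State.set_arr, State.setArr_arr, e0₁, e1₁, eh₁]
      refine ⟨by simp [hi, hN], fun i' hi' => ?_⟩
      simp only [Int.toNat_natCast, Int.toNat_zero, true_and, and_true]
      split_ifs with h'
      · rw [h']; exact hmax
      · exact h i' (by omega)
  · rintro s' - h hf
    exact hQ s' hf h

/-- Lower the threshold in variable 10 from `N + 1` to the priority of a row, in the order of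
decreasing priorities, whenever the row maximum of array 3 reaches the threshold. -/
def threshold : Stmt :=
  const 4 1 ;; dim 10 false ;; add 10 10 4 ;; loop 11 false (dim 12 false ;; sub 12 12 11 ;;
    loop 1 true (load 3 2 1 0 ;; sub 3 3 12 ;;
      ifZero 3 (load 4 3 1 0 ;; sub 4 4 10 ;; ifNeg 4 skip (copy 10 12)) skip))

/-- One sweep suffices. The threshold only drops to the level being processed, so a row of a higher
level that meets the test only afterwards already has priority above the threshold. Scanning all
rows at each level costs O(MN) and makes sorting unnecessary. `Φ` stands for whatever the lowering
rule preserves; it will be `Forced`. -/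
theorem wp_threshold (Φ : ℤ → Prop) (h0 : s.var 0 = 0) (hN : 0 < N) (hNB : 2 * N + 2 ≤ B)
    (hp : ∀ i < M, 1 ≤ s.arr 2 i 0 ∧ s.arr 2 i 0 ≤ N + 1)
    (hh : ∀ i < M, 0 ≤ s.arr 3 i 0 ∧ s.arr 3 i 0 ≤ N + 1) (start : Φ (N + 1))
    (lower : ∀ q, 1 ≤ q → Φ q → ∀ i < M, q ≤ s.arr 3 i 0 → Φ (s.arr 2 i 0))
    (hQ : ∀ s', Frame threshold s s' → Φ (s'.var 10) → 1 ≤ s'.var 10 → s'.var 10 ≤ N + 1 →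
      (∀ i < M, s'.var 10 ≤ s.arr 3 i 0 → s'.var 10 ≤ s.arr 2 i 0) → Q s') :
    wp M N B threshold Q s := by
  refine wp_framed ?_
  refine wp_seq ⟨by simp; omega, wp_seq (wp_dim (wp_seq ⟨?_, ?_⟩))⟩
  · simp [extent]; omega
  -- After `k` rounds the levels above `N - k` are settled. Level `N + 1` needs no round, because
  -- the threshold never exceeds `N + 1`.
  refine wp_loop (fun k s' => Φ (s'.var 10) ∧ 1 ≤ s'.var 10 ∧ (N : ℤ) - k + 1 ≤ s'.var 10 ∧
      s'.var 10 ≤ N + 1 ∧ ∀ i < M, (N : ℤ) - k < s.arr 2 i 0 → s'.var 10 ≤ s.arr 3 i 0 →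
        s'.var 10 ≤ s.arr 2 i 0) (by decide) ?_ ?_ ?_
  · simp [extent]
    exact ⟨start, fun i hi h' _ => by omega⟩
  · rintro k hk s' hf h11 ⟨hΦ, hq1, hqk, hqN, hcl⟩
    replace hk : k < N := hk
    have e0 : s'.var 0 = 0 := by rw [hf.var 0 (by decide)]; simpa using h0
    have e2 : s'.arr 2 = s.arr 2 := by rw [hf.arr 2 (by decide)]; rfl
    have e3 : s'.arr 3 = s.arr 3 := by rw [hf.arr 3 (by decide)]; rfl
    refine wp_seq (wp_dim (wp_seq ⟨?_, ?_⟩))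
    · simp [extent, h11]; omega
    refine wp_loop (fun i s₁ => Φ (s₁.var 10) ∧ 1 ≤ s₁.var 10 ∧ (N : ℤ) - k ≤ s₁.var 10 ∧
      s₁.var 10 ≤ N + 1 ∧ (∀ i' < M, (N : ℤ) - k < s.arr 2 i' 0 → s₁.var 10 ≤ s.arr 3 i' 0 →
        s₁.var 10 ≤ s.arr 2 i' 0) ∧ ∀ i' < i, s.arr 2 i' 0 = (N : ℤ) - k →
        s₁.var 10 ≤ s.arr 3 i' 0 → s₁.var 10 ≤ s.arr 2 i' 0) (by decide) ?_ ?_ ?_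
    · simp
      exact ⟨hΦ, hq1, by omega, hqN, hcl⟩
    · rintro i hi s₁ hf₁ h1 ⟨hΦ₁, hq1₁, hqk₁, hqN₁, hcl₁, hcl'⟩
      replace hi : i < M := hi
      have e0₁ : s₁.var 0 = 0 := by rw [hf₁.var 0 (by decide)]; simpa using e0
      have e12 : s₁.var 12 = (N : ℤ) - k := by
        rw [hf₁.var 12 (by decide)]; simp [extent, h11]
      have e2₁ : s₁.arr 2 = s.arr 2 := by rw [hf₁.arr 2 (by decide)]; simpa using e2
      have e3₁ : s₁.arr 3 = s.arr 3 := by rw [hf₁.arr 3 (by decide)]; simpa using e3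
      have := hp i hi
      have := hh i hi
      simp only [wp, State.set_var, State.set_arr, e0₁, h1, e12, e2₁, e3₁]
      simp [hi, hN, -Order.lt_add_one_iff]
      refine ⟨by omega, fun hz => ⟨by omega, fun hlt => ⟨hΦ₁, hq1₁, by omega, by omega, hcl₁,
        fun i' hi' he hq => ?_⟩, fun hge => ⟨?_, by omega, by omega, fun i' hi' hlt hq => by omega,
        fun i' hi' he hq => by omega⟩⟩, fun hz => ⟨hΦ₁, hq1₁, by omega, by omega, hcl₁,
        fun i' hi' he hq => ?_⟩⟩
      · rcases Nat.lt_succ_iff_lt_or_eq.1 hi' with hi' | rfl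
        · exact hcl' i' hi' he hq
        · omega
      · have := lower _ hq1₁ hΦ₁ i hi (by omega)
        rwa [show s.arr 2 i 0 = (N : ℤ) - k by omega] at this
      · rcases Nat.lt_succ_iff_lt_or_eq.1 hi' with hi' | rfl
        · exact hcl' i' hi' he hq
        · omega
    · rintro s₁ - ⟨hΦ₁, hq1₁, hqk₁, hqN₁, hcl₁, hcl'⟩
      simp
      refine ⟨hΦ₁, hq1₁, by omega, hqN₁, fun i hi hlt hq => ?_⟩
      rcases (show (N : ℤ) - k < s.arr 2 i 0 ∨ s.arr 2 i 0 = (N : ℤ) - k by omega) with h | h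
      · exact hcl₁ i hi h hq
      · exact hcl' i hi h hq
  · rintro s' - ⟨hΦ, hq1, hqk, hqN, hcl⟩ hf
    -- After `N` rounds all levels from 1 on are settled, and no priority is smaller.
    refine hQ s' hf hΦ hq1 hqN fun i hi hq => hcl i hi ?_ hq
    have := hp i hi
    simp [extent]
    omega

/-- Add 1 to the columns of array 1 whose entry in array 4 reaches the threshold. -/
def addColumns : Stmt :=
  loop 1 true (loop 2 false (load 12 4 0 2 ;; sub 12 12 10 ;;
    ifNeg 12 skip (load 3 1 1 2 ;; const 4 1 ;; add 3 3 4 ;; store 1 1 2 3)))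

theorem wp_addColumns {L : ℕ} (h0 : s.var 0 = 0)
    (hL : ∀ i < M, ∀ j < N, (s.arr 1 i j).natAbs ≤ L) (hB : L + 1 ≤ B)
    (hg : ∀ j < N, 0 ≤ s.arr 4 0 j ∧ s.arr 4 0 j ≤ N + 1) (hNB : N + 1 ≤ B)
    (hq : 1 ≤ s.var 10 ∧ s.var 10 ≤ N + 1)
    (hQ : ∀ s', Frame addColumns s s' → (∀ i < M, ∀ j < N, s'.arr 1 i j =
      s.arr 1 i j + if s.var 10 ≤ s.arr 4 0 j then 1 else 0) → Q s') :
    wp M N B addColumns Q s := by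
  refine wp_framed ?_
  refine wp_loop (fun k s' => ∀ i < M, ∀ j < N, s'.arr 1 i j =
      s.arr 1 i j + if s.var 10 ≤ s.arr 4 0 j ∧ i < k then 1 else 0) (by decide) ?_ ?_ ?_
  · simp
  · intro i hi s' hf h1 h
    replace hi : i < M := hi
    have hM : 0 < M := by omega
    refine wp_loop (fun k s₁ => ∀ i' < M, ∀ j < N, s₁.arr 1 i' j =
      s.arr 1 i' j + if s.var 10 ≤ s.arr 4 0 j ∧ (i' < i ∨ i' = i ∧ j < k) then 1 else 0)
      (by decide) ?_ ?_ ?_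
    · simpa using h
    · intro j hj s₁ hf₁ h2 h₁
      replace hj : j < N := hj
      have e0 : s₁.var 0 = 0 := by rw [hf₁.var 0 (by decide), hf.var 0 (by decide), h0]
      have e1 : s₁.var 1 = i := by rw [hf₁.var 1 (by decide), h1]
      have e10 : s₁.var 10 = s.var 10 := by rw [hf₁.var 10 (by decide), hf.var 10 (by decide)]
      have eg : s₁.arr 4 = s.arr 4 := by rw [hf₁.arr 4 (by decide), hf.arr 4 (by decide)]
      have ev : s₁.arr 1 i j = s.arr 1 i j := by rw [h₁ i hi j hj]; simp
      have := hg j hj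
      have := hL i hi j hj
      simp only [wp, State.set_var, State.set_arr, e0, e1, e10, eg, h2]
      simp [hi, hM, hj, ev]
      refine ⟨by omega, fun hlt i' hi' j' hj' => ?_, fun hge => ⟨by omega, by omega,
        fun i' hi' j' hj' => ?_⟩⟩
      · rw [h₁ i' hi' j' hj']
        by_cases hc : i' = i ∧ j' = j
        · obtain ⟨rfl, rfl⟩ := hc
          simp [show ¬ s.var 10 ≤ s.arr 4 0 j' by omega]
        · simp [show (i' < i ∨ i' = i ∧ j' < j) ↔ (i' < i ∨ i' = i ∧ j' ≤ j) by omega]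
      · rw [h₁ i' hi' j' hj']
        by_cases hc : i' = i ∧ j' = j
        · obtain ⟨rfl, rfl⟩ := hc
          simp [hge]
        · simp [hc, show (i' < i ∨ i' = i ∧ j' < j) ↔ (i' < i ∨ i' = i ∧ j' ≤ j) by omega]
    · intro s₁ hf₁ h₁ i' hi' j hj
      rw [State.set_arr, h₁ i' hi' j hj]
      simp [extent, hj, show (i' < i ∨ i' = i) ↔ i' ≤ i by omega]
  · rintro s' - h hf
    refine hQ s' hf fun i hi j hj => ?_
    rw [h i hi j hj]
    simp [extent, hi]

end ArrayProgram

/-! ### Writing the flipped-back matrix; double sums of mixed differences. -/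

namespace ArrayProgram
open Stmt
variable {M N B : ℕ} {s : State} {Q : State → Prop}

/-- Turn the rows of array 1, which hold the matrix up to a flip of every other entry, into array 0,
and set variable 5 if some entry is neither 0 nor 1. -/
def emit : Stmt :=
  const 7 1 ;; loop 1 true (copy 6 7 ;; loop 2 false (load 3 1 1 2 ;; const 4 2 ;; sub 4 3 4 ;;
    ifNeg 4 skip (const 5 1) ;; ifNeg 6 (const 4 1 ;; sub 3 4 3) skip ;; store 0 1 2 3 ;;
    sub 6 0 6) ;; sub 7 0 7)

/-- The entry `z`, flipped if `k` is odd. -/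
def flip (k : ℕ) (z : ℤ) : ℤ := if Even k then z else 1 - z

/-- Parity is tracked by signs: variable 7 carries `(-1) ^ i` and variable 6 carries `(-1) ^ (i +
j)`. Since variable 0 holds 0, subtracting from it negates. -/
theorem wp_emit {L : ℕ} (h0 : s.var 0 = 0) (h5 : s.var 5 = 0 ∨ s.var 5 = 1)
    (hL : ∀ i < M, ∀ j < N, (s.arr 1 i j).natAbs ≤ L) (hB : L + 2 ≤ B)
    (hQ : ∀ s', Frame emit s s' →
      (s'.var 5 = 0 ∧ s.var 5 = 0 ∧ (∀ i < M, ∀ j < N, s.arr 1 i j ≤ 1) ∨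
        s'.var 5 = 1 ∧ (s.var 5 = 1 ∨ ∃ i < M, ∃ j < N, 2 ≤ s.arr 1 i j)) →
      (∀ i < M, ∀ j < N, s'.arr 0 i j = flip (i + j) (s.arr 1 i j)) → Q s') :
    wp M N B emit Q s := by
  refine wp_framed ?_
  refine wp_seq ⟨by simp; omega, ?_⟩
  refine wp_loop (fun k s' => s'.var 7 = (-1) ^ k ∧
    (s'.var 5 = 0 ∧ s.var 5 = 0 ∧ (∀ i < k, ∀ j < N, s.arr 1 i j ≤ 1) ∨
        s'.var 5 = 1 ∧ (s.var 5 = 1 ∨ ∃ i < M, ∃ j < N, 2 ≤ s.arr 1 i j)) ∧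
    (∀ i < k, ∀ j < N, s'.arr 0 i j = flip (i + j) (s.arr 1 i j))) (by decide) ?_ ?_ ?_
  · simp
    omega
  · rintro i hi s' hf h1 ⟨h7, hbad, hout⟩
    replace hi : i < M := hi
    have e0 : s'.var 0 = 0 := by rw [hf.var 0 (by decide)]; simpa using h0
    have e1 : s'.arr 1 = s.arr 1 := by rw [hf.arr 1 (by decide)]; rfl
    refine wp_seq (show wp M N B _ _ (s'.set 6 (s'.var 7)) from wp_seq ?_)
    refine wp_loop (fun k s₁ => s₁.var 6 = (-1) ^ (i + k) ∧
      (s₁.var 5 = 0 ∧ s.var 5 = 0 ∧ (∀ i' j, i' < i ∧ j < N ∨ i' = i ∧ j < k → s.arr 1 i' j ≤ 1) ∨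
        s₁.var 5 = 1 ∧ (s.var 5 = 1 ∨ ∃ i < M, ∃ j < N, 2 ≤ s.arr 1 i j)) ∧
      (∀ i' j, i' < i ∧ j < N ∨ i' = i ∧ j < k →
        s₁.arr 0 i' j = flip (i' + j) (s.arr 1 i' j))) (by decide) ?_ ?_ ?_
    · refine ⟨by simp [h7], ?_, ?_⟩
      · refine Or.imp (fun h => ⟨by simpa using h.1, h.2.1, ?_⟩)
          (fun h => ⟨by simpa using h.1, h.2⟩) hbad
        rintro i' j (⟨hi', hj⟩ | ⟨-, hj⟩)
        exacts [h.2.2 i' hi' j hj, absurd hj (by omega)]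
      · rintro i' j (⟨hi', hj⟩ | ⟨-, hj⟩)
        exacts [hout i' hi' j hj, absurd hj (by omega)]
    · rintro j hj s₁ hf₁ h2 ⟨h6, hbad₁, hout₁⟩
      replace hj : j < N := hj
      have e0₁ : s₁.var 0 = 0 := by rw [hf₁.var 0 (by decide)]; simpa using e0
      have e1₁ : s₁.var 1 = i := by rw [hf₁.var 1 (by decide)]; simpa using h1
      have ea₁ : s₁.arr 1 = s.arr 1 := by rw [hf₁.arr 1 (by decide)]; simpa using e1
      have hLj := hL i hi j hj
      have hcase : ∀ i' j', i' < i ∧ j' < N ∨ i' = i ∧ j' < j + 1 →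
          (i' < i ∧ j' < N ∨ i' = i ∧ j' < j) ∧ ¬ (i' = i ∧ j' = j) ∨ i' = i ∧ j' = j := by
        intros; omega
      -- The common continuation after the test for an entry above 1, whose outcomes differ only in
      -- the flag.
      have tail : ∀ s₂ : State, s₂.var 0 = 0 → s₂.var 1 = i → s₂.var 2 = j →
          s₂.var 3 = s.arr 1 i j → s₂.var 6 = (-1) ^ (i + j) → s₂.arr = s₁.arr →
          (s₂.var 5 = 0 ∧ s.var 5 = 0 ∧
            (∀ i' j', i' < i ∧ j' < N ∨ i' = i ∧ j' < j + 1 → s.arr 1 i' j' ≤ 1) ∨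
            s₂.var 5 = 1 ∧ (s.var 5 = 1 ∨ ∃ i < M, ∃ j < N, 2 ≤ s.arr 1 i j)) →
          wp M N B (ifNeg 6 (const 4 1 ;; sub 3 4 3) skip ;; store 0 1 2 3 ;; sub 6 0 6)
            (fun s₁ => s₁.var 6 = (-1) ^ (i + (j + 1)) ∧
              (s₁.var 5 = 0 ∧ s.var 5 = 0 ∧
                (∀ i' j', i' < i ∧ j' < N ∨ i' = i ∧ j' < j + 1 → s.arr 1 i' j' ≤ 1) ∨
                s₁.var 5 = 1 ∧ (s.var 5 = 1 ∨ ∃ i < M, ∃ j < N, 2 ≤ s.arr 1 i j)) ∧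
              (∀ i' j', i' < i ∧ j' < N ∨ i' = i ∧ j' < j + 1 →
                s₁.arr 0 i' j' = flip (i' + j') (s.arr 1 i' j'))) s₂ := by
        intro s₂ g0 g1 g2 g3 g6 ga g5
        have hflip : (1 - s.arr 1 i j).natAbs ≤ B := by
          clear g5 hbad hbad₁
          omega
        have h1B : 1 ≤ B := (Nat.le_add_left 1 (L + 1)).trans hB
        have hsign : (s₂.var 6).natAbs ≤ B := by
          rw [g6, Int.natAbs_pow]; simp; omega
        have hpow : -(-1 : ℤ) ^ (i + j) = (-1) ^ (i + (j + 1)) := by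
          rw [← add_assoc, pow_succ]; ring
        have fin : ∀ z, z = flip (i + j) (s.arr 1 i j) → ∀ i' j',
            i' < i ∧ j' < N ∨ i' = i ∧ j' < j + 1 →
            (if i' = i ∧ j' = j then z else s₁.arr 0 i' j') = flip (i' + j') (s.arr 1 i' j') := by
          rintro z rfl i' j' hp
          rcases hcase i' j' hp with ⟨h, hn⟩ | ⟨rfl, rfl⟩
          · rw [if_neg hn, hout₁ i' j' h]
          · simp
        simp only [wp, State.set_var, State.set_arr, State.setArr_var, State.setArr_arr, ga]
        simp [g0, g1, g2, g3, hi, hj, -Order.lt_add_one_iff]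
        refine ⟨fun hneg => ⟨h1B, hflip, hsign, by rw [g6, hpow], g5, fin _ ?_⟩,
          fun hpos => ⟨hsign, by rw [g6, hpow], g5, fin _ ?_⟩⟩
        · rw [flip, if_neg]
          intro he
          rw [g6, he.neg_one_pow] at hneg
          omega
        · rw [flip, if_pos]
          by_contra he
          rw [g6, (Nat.not_even_iff_odd.1 he).neg_one_pow] at hpos
          omega
      refine wp_seq ⟨by simp [e1₁, h2, hi, hj], wp_seq ⟨by simp; omega, wp_seq ⟨?_, wp_seq
        ⟨fun hneg => tail _ ?_ ?_ ?_ ?_ ?_ ?_ ?_, fun hpos => ⟨by simp; omega,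
          tail _ ?_ ?_ ?_ ?_ ?_ ?_ ?_⟩⟩⟩⟩⟩
      all_goals try simp [e0₁, e1₁, h2, ea₁, h6, -Order.lt_add_one_iff]
      · omega
      · replace hneg : s.arr 1 i j ≤ 1 := by simpa [e1₁, h2, ea₁] using hneg
        refine hbad₁.imp (fun h => ⟨h.1, h.2.1, fun i' j' hp => ?_⟩) id
        rcases hcase i' j' hp with ⟨h', -⟩ | ⟨rfl, rfl⟩
        exacts [h.2.2 i' j' h', hneg]
      · replace hpos : 2 ≤ s.arr 1 i j := by simpa [e1₁, h2, ea₁] using hpos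
        exact Or.inr ⟨i, hi, j, hj, hpos⟩
    · rintro s₁ hf₁ ⟨-, hbad₁, hout₁⟩
      have e0₁ : s₁.var 0 = 0 := by rw [hf₁.var 0 (by decide)]; simpa using e0
      have e7 : s₁.var 7 = (-1) ^ i := by rw [hf₁.var 7 (by decide)]; simpa using h7
      have hcase : ∀ i' j, i' < i + 1 → j < N → i' < i ∧ j < N ∨ i' = i ∧ j < N := by
        intros; omega
      refine ⟨?_, ?_, ?_, ?_⟩
      · rw [e0₁, e7, zero_sub, Int.natAbs_neg, Int.natAbs_pow]; simp; omega
      · simp [e0₁, e7, pow_succ]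
      · refine Or.imp (fun h => ⟨by simpa using h.1, h.2.1, fun i' hi' j hj => ?_⟩)
          (fun h => ⟨by simpa using h.1, h.2⟩) hbad₁
        exact h.2.2 i' j (hcase i' j hi' hj)
      · exact fun i' hi' j hj => hout₁ i' j (hcase i' j hi' hj)
  · rintro s' - ⟨-, hbad, hout⟩ hf
    exact hQ s' hf hbad hout

/-- A window sum of a 0-1 matrix is at least 0 and at most 4. -/
def InRange (z : ℤ) : Prop := 0 ≤ z ∧ z ≤ 4

instance (z : ℤ) : Decidable (InRange z) := inferInstanceAs (Decidable (_ ∧ _))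

/-- The mixed difference of the flipped matrix; entries out of range are replaced by 2. -/
def mixedDiff (S : ℕ → ℕ → ℤ) (i j : ℕ) : ℤ :=
  if InRange (S i j) then (S i j - 2) * (-1) ^ (i + j) else 0

/-- Double sums of the mixed differences. -/
def doubleSum (S : ℕ → ℕ → ℤ) (i j : ℕ) : ℤ :=
  ∑ a ∈ Finset.range i, ∑ b ∈ Finset.range j, mixedDiff S a b

theorem doubleSum_succ (S : ℕ → ℕ → ℤ) (i j : ℕ) : doubleSum S (i + 1) (j + 1) =
    mixedDiff S i j + doubleSum S i (j + 1) + doubleSum S (i + 1) j - doubleSum S i j := by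
  simp only [doubleSum, Finset.sum_range_succ, Finset.sum_add_distrib]
  ring

theorem natAbs_mixedDiff_le (S : ℕ → ℕ → ℤ) (i j : ℕ) : (mixedDiff S i j).natAbs ≤ 2 := by
  rw [mixedDiff]
  split_ifs with h
  · rw [Int.natAbs_mul, Int.natAbs_pow]
    obtain ⟨h, h'⟩ := h
    simp
    omega
  · simp

/-- Clamping bounds each summand by 2. Sums of the raw entries could be as large as the product of
MN and the largest entry, which the word length does not allow. -/
theorem natAbs_doubleSum_le (S : ℕ → ℕ → ℤ) (i j : ℕ) :
    (doubleSum S i j).natAbs ≤ 2 * (i * j) := by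
  have h : ∀ a b, |mixedDiff S a b| ≤ 2 := fun a b => by
    have := natAbs_mixedDiff_le S a b
    exact abs_le.2 ⟨by omega, by omega⟩
  have : |doubleSum S i j| ≤ ∑ a ∈ Finset.range i, ∑ b ∈ Finset.range j, 2 :=
    (Finset.abs_sum_le_sum_abs _ _).trans (Finset.sum_le_sum fun a _ =>
      (Finset.abs_sum_le_sum_abs _ _).trans (Finset.sum_le_sum fun b _ => h a b))
  simp at this
  zify
  linarith

end ArrayProgram

/-! ### Reading the input and building the double sums. -/

namespace ArrayProgram
open Stmt
variable {M B n : ℕ} {s : State} {Q : State → Prop}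

/-- Variable 3 := entry of the input matrix with indices one less than variables 1 and 2. -/
def readEntry : Stmt :=
  const 4 1 ;; sub 13 1 4 ;; dim 14 false ;; sub 14 14 4 ;; mul 13 13 14 ;; add 13 13 2 ;;
    sub 13 13 4 ;; loadLin 3 13

/-- The input has row length `n` but the arrays have row length `n + 1`, so an input entry appears
in array 0 at the quotient and remainder of its linear index. -/
theorem wp_readEntry {i j : ℕ} (h1 : s.var 1 = i + 1) (h2 : s.var 2 = j + 1) (hi : i + 1 < M)
    (hj : j < n) (hB : 2 * (M * (n + 1)) ≤ B)
    (hQ : ∀ s', Frame readEntry s s' →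
      s'.var 3 = s.arr 0 ((i * n + j) / (n + 1)) ((i * n + j) % (n + 1)) → Q s') :
    wp M (n + 1) B readEntry Q s := by
  refine wp_framed ?_
  have h := mul_add_lt (show i < M by omega) hj
  have hM : M * (n + 1) = M * n + M := by ring
  have hM' : (M : ℤ) * ((n : ℤ) + 1) = M * n + M := by ring
  have hx : ((i : ℤ) * n + (j + 1)).toNat = i * n + j + 1 := by
    rw [show (i : ℤ) * n + (j + 1) = ((i * n + j + 1 : ℕ) : ℤ) by push_cast; ring,
      Int.toNat_natCast]
  have hi0 : 0 ≤ i * n := Nat.zero_le _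
  have hn : n ≤ M * n := Nat.le_mul_of_pos_left n (by omega)
  simp only [readEntry, wp, State.set_var, State.set_arr, h1, h2]
  simp [extent, hx]
  zify at h hn hM hB hi0
  refine ⟨by omega, by omega, by omega, by omega, by omega, by omega, ⟨by omega, by omega⟩,
    fun hf => hQ _ hf (by simp)⟩

/-- The condition for an entry at `(i', j')` to be known when the loops have reached `(i, j)`. -/
def Known (i j i' j' : ℕ) : Prop := i' = 0 ∨ j' = 0 ∨ i' < i ∨ i' = i ∧ j' < j

/-- Replace variable 3 by 2 and set variable 5 if variable 3 is out of range. -/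
def clampEntry : Stmt :=
  ifNeg 3 (const 3 2 ;; const 5 1) skip ;; const 4 4 ;; sub 4 4 3 ;;
    ifNeg 4 (const 3 2 ;; const 5 1) skip

theorem wp_clampEntry {N K : ℕ} (hK : (s.var 3).natAbs ≤ K) (hB : K + 6 ≤ B)
    (hQ : ∀ s', Frame clampEntry s s' → (InRange (s.var 3) ∧ s'.var 3 = s.var 3 ∧
      s'.var 5 = s.var 5 ∨ ¬ InRange (s.var 3) ∧ s'.var 3 = 2 ∧ s'.var 5 = 1) → Q s') :
    wp M N B clampEntry Q s := by
  refine wp_framed ?_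
  simp only [clampEntry, wp, State.set_var]
  simp
  refine ⟨fun h => ⟨by omega, by omega, by omega, by omega, fun hf => hQ _ hf ?_⟩,
    fun h => ⟨by omega, by omega, fun h' => ⟨by omega, by omega, fun hf => hQ _ hf ?_⟩,
      fun h' hf => hQ _ hf ?_⟩⟩
  · refine Or.inr ⟨fun hr => ?_, by simp⟩
    exact absurd hr.1 (by omega)
  · refine Or.inr ⟨fun hr => ?_, by simp⟩
    exact absurd hr.2 (by omega)
  · exact Or.inl ⟨⟨h, h'⟩, by simp⟩

/-- Compute the entry of array 1 from its neighbours and variable 3. -/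
def accumulate : Stmt :=
  const 4 2 ;; sub 3 3 4 ;; mul 3 3 6 ;; const 4 1 ;; sub 13 1 4 ;; sub 14 2 4 ;;
    load 12 1 13 2 ;; add 3 3 12 ;; load 12 1 1 14 ;; add 3 3 12 ;; load 12 1 13 14 ;; sub 3 3 12 ;;
    store 1 1 2 3

theorem wp_accumulate {N i j L : ℕ} (h1 : s.var 1 = i + 1) (h2 : s.var 2 = j + 1)
    (hi : i + 1 < M) (hj : j + 1 < N) (h3 : InRange (s.var 3))
    (h6 : s.var 6 = 1 ∨ s.var 6 = -1)
    (hL₁ : (s.arr 1 i (j + 1)).natAbs ≤ L) (hL₂ : (s.arr 1 (i + 1) j).natAbs ≤ L)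
    (hL₃ : (s.arr 1 i j).natAbs ≤ L) (hB : 3 * L + 2 ≤ B) (hMB : M ≤ B) (hNB : N ≤ B)
    (hQ : ∀ s', Frame accumulate s s' → (∀ i' j', s'.arr 1 i' j' =
      if i' = i + 1 ∧ j' = j + 1 then (s.var 3 - 2) * s.var 6 + s.arr 1 i (j + 1) +
        s.arr 1 (i + 1) j - s.arr 1 i j else s.arr 1 i' j') → Q s') :
    wp M N B accumulate Q s := by
  refine wp_framed ?_
  obtain ⟨h3, h3'⟩ := h3
  have hp : ((s.var 3 - 2) * s.var 6).natAbs ≤ 2 := by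
    rcases h6 with h | h <;> rw [h] <;> omega
  simp only [accumulate, wp, State.set_var, State.set_arr, h1, h2]
  have ti : ((i : ℤ) + 1).toNat = i + 1 := by omega
  have tj : ((j : ℤ) + 1).toNat = j + 1 := by omega
  simp [ti, tj]
  refine ⟨by omega, by omega, by omega, by omega, by omega, by omega, by omega, by omega,
    by omega, by omega, by omega, by omega, by omega, fun hf => hQ _ hf fun i' j' => ?_⟩
  simp

/-- Fill array 1 with the double sums of the input matrix; set variable 5 if the input matrix has an
entry out of range. -/
def build : Stmt :=
  const 7 1 ;; loop 1 true (copy 6 7 ;; loop 2 false (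
    ifZero 1 skip (ifZero 2 skip (readEntry ;; clampEntry ;; accumulate)) ;; sub 6 0 6) ;;
    sub 7 0 7)

/-- What is known when the loops of `build` have reached `(i, j)`. -/
structure BuildInv (M n : ℕ) (S : ℕ → ℕ → ℤ) (i j : ℕ) (s : State) : Prop where
  known : ∀ i' j', j' < n + 1 → Known i j i' j' → s.arr 1 i' j' = doubleSum S i' j'
  flag : s.var 5 = 0 ∨ s.var 5 = 1
  sound : s.var 5 = 1 → ∃ i' j', i' + 1 < M ∧ j' < n ∧ ¬ InRange (S i' j')
  complete : s.var 5 = 0 → ∀ i' j', j' < n → Known i j (i' + 1) (j' + 1) → InRange (S i' j')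

/-- The initial zeros are already correct in the first row and column; every other entry follows
from three earlier neighbours by `doubleSum_succ`. -/
theorem wp_build {S : ℕ → ℕ → ℤ} {K : ℕ} (h0 : s.var 0 = 0) (h5 : s.var 5 = 0)
    (h1 : ∀ i j, s.arr 1 i j = 0) (hM : 0 < M)
    (hS : ∀ i j, i + 1 < M → j < n →
      s.arr 0 ((i * n + j) / (n + 1)) ((i * n + j) % (n + 1)) = S i j)
    (hK : ∀ i j, i + 1 < M → j < n → (S i j).natAbs ≤ K)
    (hB : 6 * (M * (n + 1)) + K + 6 ≤ B)
    (hQ : ∀ s', Frame build s s' → (∀ i < M, ∀ j < n + 1, s'.arr 1 i j = doubleSum S i j) →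
      (s'.var 5 = 0 ∧ (∀ i j, i + 1 < M → j < n → InRange (S i j)) ∨
        s'.var 5 = 1 ∧ ∃ i j, i + 1 < M ∧ j < n ∧ ¬ InRange (S i j)) → Q s') :
    wp M (n + 1) B build Q s := by
  refine wp_framed ?_
  have hMB : M ≤ M * (n + 1) := Nat.le_mul_of_pos_right M (by omega)
  have hnB : n + 1 ≤ M * (n + 1) := Nat.le_mul_of_pos_left (n + 1) hM
  have hsign : ∀ k : ℕ, (-(-1 : ℤ) ^ k).natAbs ≤ B := fun k => by
    rw [Int.natAbs_neg, Int.natAbs_pow]; simp; omega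
  refine wp_seq ⟨by simp; omega, ?_⟩
  refine wp_loop (fun i s' => s'.var 7 = (-1) ^ i ∧ BuildInv M n S i 0 s') (by decide) ?_ ?_ ?_
  · refine ⟨by simp, fun i' j' _ hk => ?_, by simp [h5], by simp [h5], fun _ i' j' _ hk => ?_⟩
    · rw [State.set_arr, State.set_arr, h1, doubleSum]
      rcases hk with rfl | rfl | hk | hk
      · simp
      · simp
      all_goals omega
    · simp [Known] at hk
  · rintro i hi s' hf g1 ⟨h7, hinv⟩
    replace hi : i < M := hi
    have e0 : s'.var 0 = 0 := by rw [hf.var 0 (by decide)]; simpa using h0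
    have ea : s'.arr 0 = s.arr 0 := by rw [hf.arr 0 (by decide)]; rfl
    refine wp_seq (show wp M (n + 1) B _ _ (s'.set 6 (s'.var 7)) from wp_seq ?_)
    refine wp_loop (fun j s₁ => s₁.var 6 = (-1) ^ (i + j) ∧ BuildInv M n S i j s₁) (by decide)
      ?_ ?_ ?_
    · exact ⟨by simp [h7], hinv.known, by simpa using hinv.flag, by simpa using hinv.sound,
        by simpa using hinv.complete⟩
    · rintro j hj s₁ hf₁ g2 ⟨h6, hinv₁⟩
      replace hj : j < n + 1 := hj
      have e0₁ : s₁.var 0 = 0 := by rw [hf₁.var 0 (by decide)]; simpa using e0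
      have e1₁ : s₁.var 1 = i := by rw [hf₁.var 1 (by decide)]; simpa using g1
      have ea₁ : s₁.arr 0 = s.arr 0 := by rw [hf₁.arr 0 (by decide)]; simpa using ea
      have fin : ∀ s₂ : State, s₂.var 0 = 0 → s₂.var 6 = (-1) ^ (i + j) →
          BuildInv M n S i (j + 1) s₂ →
          wp M (n + 1) B (sub 6 0 6) (fun s₃ =>
            (s₃.set 2 ((j : ℤ) + 1)).var 6 = (-1) ^ (i + (j + 1)) ∧
              BuildInv M n S i (j + 1) (s₃.set 2 ((j : ℤ) + 1))) s₂ := by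
        intro s₂ k0 k6 k
        refine ⟨by rw [k0, k6, zero_sub]; exact hsign _, ?_, k.known, by simpa using k.flag,
          by simpa using k.sound, by simpa using k.complete⟩
        simp [k0, k6, ← add_assoc, pow_succ]
      have border : i = 0 ∨ j = 0 → BuildInv M n S i (j + 1) s₁ := by
        intro hb
        refine ⟨fun i' j' hj' hk => hinv₁.known i' j' hj' ?_, hinv₁.flag, hinv₁.sound,
          fun h i' j' hj' hk => hinv₁.complete h i' j' hj' ?_⟩ <;>
        · simp only [Known] at hk ⊢
          omega
      refine wp_seq ⟨fun hz => fin _ e0₁ h6 (border (by omega)), fun hi0 => ⟨fun hz => fin _ e0₁ h6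
        (border (by omega)), fun hj0 => ?_⟩⟩
      obtain ⟨i, rfl⟩ := Nat.exists_eq_add_one_of_ne_zero (show i ≠ 0 by omega)
      obtain ⟨j, rfl⟩ := Nat.exists_eq_add_one_of_ne_zero (show j ≠ 0 by omega)
      have hj' : j < n := by omega
      refine wp_seq (wp_readEntry (i := i) (j := j) (by simpa using e1₁) (by simpa using g2) hi hj'
        (by omega) ?_)
      intro s₂ hf₂ h3
      rw [ea₁, hS i j hi hj'] at h3
      refine wp_seq (wp_clampEntry (K := K) (by rw [h3]; exact hK i j hi hj') (by omega) ?_)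
      rw [h3]
      intro s₃ hf₃ hclamp
      rw [hf₂.var 5 (by decide)] at hclamp
      have e1₃ : s₃.var 1 = i + 1 := by
        rw [hf₃.var 1 (by decide), hf₂.var 1 (by decide)]; simpa using e1₁
      have e2₃ : s₃.var 2 = j + 1 := by
        rw [hf₃.var 2 (by decide), hf₂.var 2 (by decide)]; simpa using g2
      have e6₃ : s₃.var 6 = (-1) ^ (i + j) := by
        rw [hf₃.var 6 (by decide), hf₂.var 6 (by decide), h6,
          show i + 1 + (j + 1) = i + j + 2 by ring, pow_add]
        simp
      have ea₃ : s₃.arr 1 = s₁.arr 1 := by rw [hf₃.arr 1 (by decide), hf₂.arr 1 (by decide)]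
      have hbd : ∀ i' j', i' < M → j' < n + 1 →
          (doubleSum S i' j').natAbs ≤ 2 * (M * (n + 1)) := fun i' j' hi' hj' =>
        (natAbs_doubleSum_le S i' j').trans (Nat.mul_le_mul_left 2 (Nat.mul_le_mul hi'.le hj'.le))
      have k₁ := hinv₁.known i (j + 1) hj (by simp [Known])
      have k₂ := hinv₁.known (i + 1) j (by omega) (by simp [Known])
      have k₃ := hinv₁.known i j (by omega) (by simp [Known])
      refine wp_accumulate (i := i) (j := j) (L := 2 * (M * (n + 1))) e1₃ e2₃ hi (by omega) ?_ ?_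
        ?_ ?_ ?_ (by omega) (by omega) (by omega) ?_
      · rcases hclamp with ⟨h, h', -⟩ | ⟨-, h', -⟩ <;> rw [h']
        · exact h
        · simp [InRange]
      · rw [e6₃]; exact neg_one_pow_eq_or ℤ _
      · rw [ea₃, k₁]; exact hbd _ _ (by omega) hj
      · rw [ea₃, k₂]; exact hbd _ _ hi (by omega)
      · rw [ea₃, k₃]; exact hbd _ _ (by omega) (by omega)
      intro s₄ hf₄ hval
      rw [ea₃, k₁, k₂, k₃, e6₃] at hval
      -- The clamped value 2 produces the default 0 of `mixedDiff`.
      have hD : (s₃.var 3 - 2) * (-1) ^ (i + j) = mixedDiff S i j := by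
        rw [mixedDiff]
        rcases hclamp with ⟨h, h', -⟩ | ⟨h, h', -⟩ <;> simp [h, h']
      rw [hD, ← doubleSum_succ] at hval
      have e5 : s₄.var 5 = s₃.var 5 := hf₄.var 5 (by decide)
      refine fin _ ?_ ?_ ⟨fun i' j' hj' hk => ?_, ?_, fun h => ?_, fun h i' j' hj' hk => ?_⟩
      · rw [hf₄.var 0 (by decide), hf₃.var 0 (by decide), hf₂.var 0 (by decide), e0₁]
      · rw [hf₄.var 6 (by decide), hf₃.var 6 (by decide), hf₂.var 6 (by decide), h6]
      · rw [hval]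
        split_ifs with h
        · rw [h.1, h.2]
        · refine hinv₁.known i' j' hj' ?_
          simp only [Known] at hk ⊢
          omega
      · rw [e5]
        rcases hclamp with ⟨-, -, h⟩ | ⟨-, -, h⟩ <;> rw [h]
        · exact hinv₁.flag
        · simp
      · rw [e5] at h
        rcases hclamp with ⟨-, -, h'⟩ | ⟨h', -, -⟩
        · exact hinv₁.sound (h' ▸ h)
        · exact ⟨i, j, hi, hj', h'⟩
      · rw [e5] at h
        rcases hclamp with ⟨hr, -, h'⟩ | ⟨-, -, h'⟩
        · by_cases he : i' = i ∧ j' = j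
          · rw [he.1, he.2]; exact hr
          · refine hinv₁.complete (h' ▸ h) i' j' hj' ?_
            simp only [Known] at hk ⊢
            omega
        · omega
    · rintro s₁ hf₁ ⟨-, hinv₁⟩
      have e0₁ : s₁.var 0 = 0 := by rw [hf₁.var 0 (by decide)]; simpa using e0
      have e7 : s₁.var 7 = (-1) ^ i := by rw [hf₁.var 7 (by decide)]; simpa using h7
      refine ⟨by rw [e0₁, e7, zero_sub]; exact hsign _, by simp [e0₁, e7, pow_succ],
        fun i' j' hj' hk => hinv₁.known i' j' hj' ?_, by simpa using hinv₁.flag,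
        by simpa using hinv₁.sound,
        fun h i' j' hj' hk => hinv₁.complete (by simpa using h) i' j' hj' ?_⟩ <;>
      · simp only [Known, extent] at hk ⊢
        simp
        omega
  · rintro s' - ⟨-, hinv⟩ hf
    have hkn : ∀ i' j', i' < M → Known (extent M (n + 1) true) 0 i' j' :=
      fun i' j' h => Or.inr (Or.inr (Or.inl h))
    refine hQ s' hf (fun i hi j hj => hinv.known i j hj (hkn i j hi)) ?_
    rcases hinv.flag with h | h
    · exact Or.inl ⟨h, fun i j hi hj => hinv.complete h i j hj (hkn _ _ hi)⟩
    · exact Or.inr ⟨h, hinv.sound h⟩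

end ArrayProgram

/-! ### Combinatorics of balanced offsets. -/

namespace ArrayProgram

variable {M N m n : ℕ}

/-- Column offsets `y` with values in `{0, 1}` for which the entries of each row of `V i j + y j`
differ by at most 1. -/
def Balanced (M N : ℕ) (V : ℕ → ℕ → ℤ) (y : ℕ → ℤ) : Prop :=
  (∀ j < N, y j = 0 ∨ y j = 1) ∧
    ∀ i < M, ∀ a < N, ∀ b < N, V i a + y a ≤ V i b + y b + 1

theorem zeros_pos {v : ℕ → ℤ} {j : ℕ} (hj : j < N) (hv : v j = 0) : 0 < zeros N v :=
  Finset.card_pos.2 ⟨j, by simp [hj, hv]⟩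

theorem zeros_lt_zeros {v w : ℕ → ℤ} {a : ℕ} (ha : a < N) (hva : v a ≠ 0) (hwa : w a = 0)
    (h : ∀ j < N, v j = 0 → w j = 0) : zeros N v < zeros N w := by
  refine Finset.card_lt_card (Finset.ssubset_iff_subset_ne.2 ⟨fun j hj => ?_, fun he => ?_⟩)
  · simp only [Finset.mem_filter, Finset.mem_range] at hj ⊢
    exact ⟨hj.1, h j hj.1 hj.2⟩
  · have : a ∈ (Finset.range N).filter fun j => v j = 0 := by rw [he]; simp [ha, hwa]
    simp [hva] at this

variable {V : ℕ → ℕ → ℤ} {y pr g h : ℕ → ℤ}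

/-- In a row whose entries are nonnegative, a column with offset 1 and nonzero entry forces offset 1
in the columns with entry zero. -/
theorem Balanced.eq_one (hy : Balanced M N V y) {i a b : ℕ} (hi : i < M) (ha : a < N) (hb : b < N)
    (hV : 0 ≤ V i a) (hva : V i a ≠ 0) (hya : y a = 1) (hvb : V i b = 0) : y b = 1 := by
  have := hy.2 i hi a ha b hb
  have := hy.1 b hb
  omega

/-- With a zero at `j`, the count alone gives a priority of at most `N`. So the row has an entry at
least 2, which is within 1 of column `j` only if that column is raised. -/
theorem Balanced.eq_one_of_priority_top (hy : Balanced M N V y) {i j : ℕ} (hi : i < M) (hj : j < N)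
    (hv : V i j = 0) {p : ℤ} (hp : IsPriority N (V i) p) (hN : (N : ℤ) + 1 ≤ p) : y j = 1 := by
  have hz := zeros_pos hj hv
  rcases hp with ⟨-, rfl⟩ | ⟨⟨a, ha, hva⟩, -⟩
  · omega
  · have := hy.2 i hi a ha j hj
    have := hy.1 j hj
    have := hy.1 a ha
    omega

/-- All balanced offsets are 1 in the columns where `g` reaches `q`. -/
def Forced (M N : ℕ) (V : ℕ → ℕ → ℤ) (g : ℕ → ℤ) (q : ℤ) : Prop :=
  ∀ y, Balanced M N V y → ∀ j < N, q ≤ g j → y j = 1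

theorem forced_top (hp : ∀ i < M, IsPriority N (V i) (pr i))
    (hg : ∀ j < N, IsMaxPriority M (fun i => V i j) pr (g j)) : Forced M N V g (N + 1) := by
  intro y hy j hj hq
  obtain ⟨i, hi, hv, he⟩ := (hg j hj).2.resolve_left (by omega)
  exact hy.eq_one_of_priority_top hi hj hv (hp i hi) (he ▸ hq)

/-- This is why one number can describe the propagation: comparing two rows comes down to counting
their zeros. -/
theorem Forced.lower (hV : ∀ i < M, ∀ j < N, 0 ≤ V i j)
    (hp : ∀ i < M, IsPriority N (V i) (pr i))
    (hg : ∀ j < N, IsMaxPriority M (fun i => V i j) pr (g j))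
    (hh : ∀ i < M, IsRowMax N (V i) g (h i)) {q : ℤ} (hq : 1 ≤ q) (hF : Forced M N V g q)
    {i : ℕ} (hi : i < M) (hqi : q ≤ h i) : Forced M N V g (pr i) := by
  intro y hy j hj hpj
  -- `1 ≤ q` rules out the default value 0 of the row maximum.
  obtain ⟨a, ha, hva, he⟩ := (hh i hi).2.resolve_left (by omega)
  have hya : y a = 1 := hF y hy a ha (he ▸ hqi)
  have hpi := (hp i hi).bounds
  obtain ⟨k, hk, hvk, hek⟩ := (hg j hj).2.resolve_left (by omega)
  dsimp only at hvk
  rw [hek] at hpj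
  by_contra hyj
  -- Otherwise row `k` itself would force offset 1 in column `j`.
  have hyz : ∀ b < N, y b = 1 → V k b = 0 := by
    intro b hb hyb
    by_contra hvb
    exact hyj (hy.eq_one hk hb hj (hV k hk b hb) hvb hyb hvk)
  -- Column `a` gives all zeros of row `i` offset 1, so they are zeros of row `k`, and so is `a`,
  -- where row `i` is nonzero.
  have hlt : zeros N (V i) < zeros N (V k) :=
    zeros_lt_zeros ha hva (hyz a ha hya) fun b hb hvb =>
      hyz b hb (hy.eq_one hi ha hb (hV i hi a ha) hva hya hvb)
  -- Top priority would force column `j` outright. So the priority of row `k` counts zeros, and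
  -- `hlt` contradicts `pr i ≤ pr k`.
  have hltop : pr k < N + 1 := by
    by_contra hge
    exact hyj (hy.eq_one_of_priority_top hk hj hvk (hp k hk) (by omega))
  rcases hp k hk with ⟨-, hk'⟩ | ⟨-, hk'⟩
  · rcases hp i hi with ⟨-, hi'⟩ | ⟨-, hi'⟩ <;> omega
  · omega

/-- If the offsets given by a forced threshold that is closed under the row rule are not balanced,
then there are no balanced offsets. -/
theorem not_balanced_of_two_le (hV : ∀ i < M, ∀ j < N, 0 ≤ V i j)
    (hV0 : ∀ i < M, ∃ j < N, V i j = 0)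
    (hp : ∀ i < M, IsPriority N (V i) (pr i))
    (hg : ∀ j < N, IsMaxPriority M (fun i => V i j) pr (g j))
    (hh : ∀ i < M, IsRowMax N (V i) g (h i)) {q : ℤ} (hqN : q ≤ N + 1)
    (hF : Forced M N V g q) (hcl : ∀ i < M, q ≤ h i → q ≤ pr i) {i a b : ℕ} (hi : i < M)
    (ha : a < N) (hb : b < N) (hab : V i b + (if q ≤ g b then 1 else 0) + 2 ≤
      V i a + if q ≤ g a then 1 else 0) (hy : Balanced M N V y) : False := by
  obtain ⟨l, hl, hvl⟩ := hV0 i hi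
  have hal := hy.2 i hi a ha l hl
  have hyl := hy.1 l hl
  have hya := hy.1 a ha
  -- Being forced, the threshold offsets lie below every balanced choice.
  have hle : (if q ≤ g a then (1 : ℤ) else 0) ≤ y a := by
    split_ifs with hc
    · exact (hF y hy a ha hc).ge
    · omega
  have hvb := hV i hi b hb
  -- Balance against the zero column `l` gives `V i a + y a ≤ 2`, so a gap of 2 leaves both entry
  -- and offset 0 in column `b`.
  have hgb : ¬ q ≤ g b := by
    intro hc
    rw [if_pos hc] at hab
    omega
  rw [if_neg hgb] at hab
  have hpb := (hg b hb).1 i hi (show V i b = 0 by omega)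
  have hhi : ¬ q ≤ h i := fun hc => hgb ((hcl i hi hc).trans hpb)
  -- The value 2 in column `a` is 1 + 1 or 2 + 0. In the first case the row rule would apply to row
  -- `i`; in the second the row has priority `N + 1`, and column `b` would reach the threshold.
  by_cases hga : q ≤ g a
  · rw [if_pos hga] at hab
    exact hhi (hga.trans ((hh i hi).1 a ha (by omega)))
  · rw [if_neg hga] at hab
    rcases hp i hi with ⟨hlt, -⟩ | ⟨-, he⟩
    · have := hlt a ha
      omega
    · omega

/-! ### Flipping every other entry -/

theorem flip_flip (k : ℕ) (z : ℤ) : flip k (flip k z) = z := by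
  unfold flip; split_ifs <;> ring

theorem flip_eq_zero_or_one (k : ℕ) {z : ℤ} (h : z = 0 ∨ z = 1) : flip k z = 0 ∨ flip k z = 1 := by
  unfold flip; split_ifs <;> omega

/-- For either parity exactly two corners are flipped, whence the constant 2. -/
theorem flip_mixedDiff (k : ℕ) (z₀₀ z₀₁ z₁₀ z₁₁ : ℤ) :
    flip k z₀₀ - flip (k + 1) z₀₁ - flip (k + 1) z₁₀ + flip (k + 2) z₁₁ =
      (z₀₀ + z₀₁ + z₁₀ + z₁₁ - 2) * (-1) ^ k := by
  rcases Nat.even_or_odd k with hk | hk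
  · have h₁ : ¬ Even (k + 1) := Nat.not_even_iff_odd.2 hk.add_one
    have h₂ : Even (k + 2) := hk.add even_two
    simp only [flip, hk, h₁, h₂, if_true, if_false, hk.neg_one_pow]
    ring
  · have h₀ : ¬ Even k := Nat.not_even_iff_odd.2 hk
    have h₁ : Even (k + 1) := hk.add_one
    have h₂ : ¬ Even (k + 2) := Nat.not_even_iff_odd.2 (hk.add_even even_two)
    simp only [flip, h₀, h₁, h₂, if_true, if_false, hk.neg_one_pow]
    ring

/-- A solution of the reconstruction problem, for matrices indexed by natural numbers. -/
def IsSolution (m n : ℕ) (S A : ℕ → ℕ → ℤ) : Prop :=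
  (∀ i < m + 1, ∀ j < n + 1, A i j = 0 ∨ A i j = 1) ∧
    ∀ i < m, ∀ j < n, A i j + A i (j + 1) + A (i + 1) j + A (i + 1) (j + 1) = S i j

variable {S A F : ℕ → ℕ → ℤ}

theorem IsSolution.inRange (hA : IsSolution m n S A) {i j : ℕ} (hi : i < m) (hj : j < n) :
    InRange (S i j) := by
  rw [← hA.2 i hi j hj]
  have h₁ := hA.1 i (by omega) j (by omega)
  have h₂ := hA.1 i (by omega) (j + 1) (by omega)
  have h₃ := hA.1 (i + 1) (by omega) j (by omega)
  have h₄ := hA.1 (i + 1) (by omega) (j + 1) (by omega)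
  constructor <;> omega

/-- Discrete integration from the first row and column. -/
theorem eq_doubleSum_add (hF : ∀ i < m, ∀ j < n,
    F i j - F i (j + 1) - F (i + 1) j + F (i + 1) (j + 1) = mixedDiff S i j) {i j : ℕ}
    (hi : i < m + 1) (hj : j < n + 1) :
    F i j = doubleSum S i j + F i 0 + F 0 j - F 0 0 := by
  induction i generalizing j with
  | zero => simp [doubleSum]
  | succ i ih =>
    induction j with
    | zero => simp [doubleSum]
    | succ j ih' =>
      have h₁ := ih (by omega) hj
      have h₂ := ih (j := j) (by omega) (by omega)
      have h₃ := ih' (by omega)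
      have h₄ := hF i (by omega) j (by omega)
      rw [doubleSum_succ]
      linarith

/-- Within a row, `V` plus the flipped first row of `A` differs by a constant from the flipped
matrix, whose entries are 0 and 1. -/
theorem IsSolution.balanced (hA : IsSolution m n S A)
    (hV : ∀ i < m + 1, ∃ lo, ∀ j < n + 1, V i j = doubleSum S i j - lo) :
    Balanced (m + 1) (n + 1) V fun j => flip j (A 0 j) := by
  have hbin : ∀ i < m + 1, ∀ j < n + 1, flip (i + j) (A i j) = 0 ∨ flip (i + j) (A i j) = 1 :=
    fun i hi j hj => flip_eq_zero_or_one _ (hA.1 i hi j hj)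
  have hF : ∀ i < m + 1, ∀ j < n + 1, flip (i + j) (A i j) =
      doubleSum S i j + flip (i + 0) (A i 0) + flip (0 + j) (A 0 j) - flip (0 + 0) (A 0 0) := by
    intro i hi j hj
    refine eq_doubleSum_add (F := fun i j => flip (i + j) (A i j)) (fun i hi j hj => ?_) hi hj
    have := flip_mixedDiff (i + j) (A i j) (A i (j + 1)) (A (i + 1) j) (A (i + 1) (j + 1))
    rw [hA.2 i hi j hj] at this
    rw [mixedDiff, if_pos (hA.inRange hi hj), ← this, ← add_assoc, add_right_comm i 1 j,
      show i + 1 + (j + 1) = i + j + 2 by ring]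
  simp only [zero_add] at hF
  refine ⟨fun j hj => by simpa using hbin 0 (by omega) j hj, fun i hi a ha b hb => ?_⟩
  obtain ⟨lo, hlo⟩ := hV i hi
  have h₁ := hF i hi a ha
  have h₂ := hF i hi b hb
  have h₃ := hbin i hi a ha
  have h₄ := hbin i hi b hb
  dsimp only
  rw [hlo a ha, hlo b hb]
  omega

/-- Shifts depending on the row alone or on the column alone cancel in mixed differences. -/
theorem isSolution_of_flip {Z : ℕ → ℕ → ℤ} {x : ℕ → ℤ}
    (hS : ∀ i < m, ∀ j < n, InRange (S i j))
    (hZ : ∀ i < m + 1, ∀ j < n + 1, Z i j = doubleSum S i j + x i + y j)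
    (hZ0 : ∀ i < m + 1, ∀ j < n + 1, 0 ≤ Z i j ∧ Z i j ≤ 1)
    (hA : ∀ i < m + 1, ∀ j < n + 1, A i j = flip (i + j) (Z i j)) : IsSolution m n S A := by
  refine ⟨fun i hi j hj => ?_, fun i hi j hj => ?_⟩
  · rw [hA i hi j hj]
    have := hZ0 i hi j hj
    exact flip_eq_zero_or_one _ (by omega)
  · have h := flip_mixedDiff (i + j) (A i j) (A i (j + 1)) (A (i + 1) j) (A (i + 1) (j + 1))
    have hA' : ∀ i < m + 1, ∀ j < n + 1, flip (i + j) (A i j) = Z i j := fun i hi j hj => by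
      rw [hA i hi j hj, flip_flip]
    have e₁ := hA' i (by omega) j (by omega)
    have e₂ := hA' i (by omega) (j + 1) (by omega)
    have e₃ := hA' (i + 1) (by omega) j (by omega)
    have e₄ := hA' (i + 1) (by omega) (j + 1) (by omega)
    rw [← add_assoc] at e₂
    rw [add_right_comm] at e₃
    rw [show i + 1 + (j + 1) = i + j + 2 by ring] at e₄
    rw [e₁, e₂, e₃, e₄, hZ i (by omega) j (by omega), hZ i (by omega) (j + 1) (by omega),
      hZ (i + 1) (by omega) j (by omega), hZ (i + 1) (by omega) (j + 1) (by omega),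
      doubleSum_succ, mixedDiff, if_pos (hS i hi j hj)] at h
    rcases neg_one_pow_eq_or ℤ (i + j) with hs | hs <;> rw [hs] at h <;> linarith

/-! ### The whole program -/

/-- The reconstruction program. At the end, variable 5 tells whether there is a solution, and array
0 holds one if there is. -/
def reconstruct : Stmt :=
  build ;; normalise ;; priorities ;; rowMaxima ;; threshold ;; addColumns ;; normalise ;; emit ;;
    .const 4 1 ;; .sub 5 4 5

/-- The zero of `v` shows that the subtracted number is itself an entry of `w`. -/
theorem NormRow.natAbs_le {w v : ℕ → ℤ} {L : ℕ} (h : NormRow N w v)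
    (hL : ∀ j < N, (w j).natAbs ≤ L) {j : ℕ} (hj : j < N) : (v j).natAbs ≤ 2 * L := by
  obtain ⟨⟨lo, hlo⟩, -, j₀, hj₀, h0⟩ := h
  have h₁ := hlo j hj
  have h₂ := hlo j₀ hj₀
  have h₃ := hL j hj
  have h₄ := hL j₀ hj₀
  omega

/-- With `X` the number of entries, array 1 is bounded successively by 2X (double sums), 4X
(normalised), 5X (offsets added) and 10X (normalised again). -/
theorem wp_reconstruct {B K : ℕ} {s : State} {Q : State → Prop} (h0 : s.var 0 = 0)
    (h5 : s.var 5 = 0) (h1 : ∀ i j, s.arr 1 i j = 0) (h4 : ∀ j < n + 1, s.arr 4 0 j = 0)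
    (hS : ∀ i j, i < m → j < n → s.arr 0 ((i * n + j) / (n + 1)) ((i * n + j) % (n + 1)) = S i j)
    (hK : ∀ i j, i < m → j < n → (S i j).natAbs ≤ K)
    (hB : 20 * ((m + 1) * (n + 1)) + K ≤ B)
    (hQ : ∀ s', (s'.var 5 = 1 ∧ IsSolution m n S (s'.arr 0) ∨
      s'.var 5 = 0 ∧ ¬ ∃ A, IsSolution m n S A) → Q s') :
    wp (m + 1) (n + 1) B reconstruct Q s := by
  set X := (m + 1) * (n + 1) with hX
  have hnX : n + 1 ≤ X := Nat.le_mul_of_pos_left (n + 1) (by omega)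
  refine wp_seq (wp_build (S := S) (K := K) h0 h5 h1 (by omega) (fun i j hi => hS i j (by omega))
    (fun i j hi => hK i j (by omega)) (by omega) ?_)
  intro s₁ hf₁ hW hbad
  have z₁ : s₁.var 0 = 0 := by rw [hf₁.var 0 (by decide), h0]
  have bW : ∀ i < m + 1, ∀ j < n + 1, (s₁.arr 1 i j).natAbs ≤ 2 * X := fun i hi j hj => by
    rw [hW i hi j hj]
    exact (natAbs_doubleSum_le S i j).trans (Nat.mul_le_mul_left 2 (Nat.mul_le_mul hi.le hj.le))
  refine wp_seq (wp_normalise (L := 2 * X) z₁ (by omega) bW (by omega) ?_)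
  intro s₂ hf₂ hnorm
  have z₂ : s₂.var 0 = 0 := by rw [hf₂.var 0 (by decide), z₁]
  have bV : ∀ i < m + 1, ∀ j < n + 1, (s₂.arr 1 i j).natAbs ≤ 4 * X := fun i hi j hj => by
    have := (hnorm i hi).natAbs_le (bW i hi) hj
    omega
  refine wp_seq (wp_priorities (L := 4 * X) z₂ (by omega) bV (by omega) (by omega) ?_ ?_)
  · intro j hj
    rw [hf₂.arr 4 (by decide), hf₁.arr 4 (by decide), h4 j hj]
  intro s₃ hf₃ hp hgb hg
  have z₃ : s₃.var 0 = 0 := by rw [hf₃.var 0 (by decide), z₂]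
  have eV₃ : s₃.arr 1 = s₂.arr 1 := hf₃.arr 1 (by decide)
  refine wp_seq (wp_rowMaxima z₃ (by omega) (by omega) hgb ?_)
  rw [eV₃]
  intro s₄ hf₄ hh
  have z₄ : s₄.var 0 = 0 := by rw [hf₄.var 0 (by decide), z₃]
  have eV₄ : s₄.arr 1 = s₂.arr 1 := by rw [hf₄.arr 1 (by decide), eV₃]
  have ep₄ : s₄.arr 2 = s₃.arr 2 := hf₄.arr 2 (by decide)
  have eg₄ : s₄.arr 4 = s₃.arr 4 := hf₄.arr 4 (by decide)
  have hV : ∀ i < m + 1, ∀ j < n + 1, 0 ≤ s₂.arr 1 i j := fun i hi => (hnorm i hi).2.1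
  refine wp_seq (wp_threshold (Forced (m + 1) (n + 1) (s₂.arr 1) (s₃.arr 4 0)) z₄ (by omega)
    (by omega) ?_ ?_ ?_ ?_ ?_)
  · intro i hi
    rw [ep₄]
    exact (hp i hi).bounds
  · intro i hi
    rcases (hh i hi).2 with h | ⟨j, hj, -, h⟩ <;> rw [h]
    · omega
    · exact hgb j hj
  · exact forced_top hp hg
  · rw [ep₄]
    exact fun q hq hF i hi hqi => hF.lower hV hp hg hh hq hi hqi
  rw [ep₄]
  intro s₅ hf₅ hF hq1 hqN hcl
  have z₅ : s₅.var 0 = 0 := by rw [hf₅.var 0 (by decide), z₄]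
  have eV₅ : s₅.arr 1 = s₂.arr 1 := by rw [hf₅.arr 1 (by decide), eV₄]
  have eg₅ : s₅.arr 4 = s₃.arr 4 := by rw [hf₅.arr 4 (by decide), eg₄]
  refine wp_seq (wp_addColumns (L := 4 * X) z₅ (by rw [eV₅]; exact bV) (by omega)
    (by rw [eg₅]; exact hgb) (by omega) ⟨hq1, hqN⟩ ?_)
  rw [eV₅, eg₅]
  intro s₆ hf₆ hadd
  have z₆ : s₆.var 0 = 0 := by rw [hf₆.var 0 (by decide), z₅]
  have bU : ∀ i < m + 1, ∀ j < n + 1, (s₆.arr 1 i j).natAbs ≤ 5 * X := fun i hi j hj => by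
    have := bV i hi j hj
    rw [hadd i hi j hj]
    split_ifs <;> omega
  refine wp_seq (wp_normalise (L := 5 * X) z₆ (by omega) bU (by omega) ?_)
  intro s₇ hf₇ hnorm'
  have z₇ : s₇.var 0 = 0 := by rw [hf₇.var 0 (by decide), z₆]
  have f₇ : s₇.var 5 = s₁.var 5 := by
    rw [hf₇.var 5 (by decide), hf₆.var 5 (by decide), hf₅.var 5 (by decide),
      hf₄.var 5 (by decide), hf₃.var 5 (by decide), hf₂.var 5 (by decide)]
  have bZ : ∀ i < m + 1, ∀ j < n + 1, (s₇.arr 1 i j).natAbs ≤ 10 * X := fun i hi j hj => by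
    have := (hnorm' i hi).natAbs_le (bU i hi) hj
    omega
  refine wp_seq (wp_emit (L := 10 * X) z₇ (by rw [f₇]; exact hbad.imp And.left And.left) bZ
    (by omega) ?_)
  rw [f₇]
  intro s₈ hf₈ hbad₈ hout
  refine wp_seq ⟨by simp; omega, ?_, hQ _ ?_⟩
  · rcases hbad₈ with ⟨h, -⟩ | ⟨h, -⟩ <;> simp [h]
    omega
  rcases hbad₈ with ⟨h, h', hle⟩ | ⟨h, h'⟩
  · refine Or.inl ⟨by simp [h], ?_⟩
    have hr := (hbad.resolve_right fun hc => by omega).2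
    have hsum : ∀ i < m + 1, ∃ x, ∀ j < n + 1, s₇.arr 1 i j =
        doubleSum S i j + x + if s₅.var 10 ≤ s₃.arr 4 0 j then 1 else 0 := by
      intro i hi
      obtain ⟨⟨lo, hlo⟩, -⟩ := hnorm i hi
      obtain ⟨⟨lo', hlo'⟩, -⟩ := hnorm' i hi
      refine ⟨-lo - lo', fun j hj => ?_⟩
      rw [hlo' j hj, hadd i hi j hj, hlo j hj, hW i hi j hj]
      ring
    choose! x hx using hsum
    exact isSolution_of_flip (Z := s₇.arr 1) (fun i hi j hj => hr i j (by omega) hj) hx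
      (fun i hi j hj => ⟨(hnorm' i hi).2.1 j hj, hle i hi j hj⟩) hout
  · refine Or.inr ⟨by simp [h], ?_⟩
    rintro ⟨A, hA⟩
    -- The flag stems from an input entry out of range or from an entry at least 2 after the second
    -- normalisation.
    rcases h' with h' | ⟨i, hi, a, ha, hia⟩
    · obtain ⟨i, j, hi, hj, hr⟩ := (hbad.resolve_left fun hc => by omega).2
      exact hr (hA.inRange (by omega) hj)
    · obtain ⟨⟨lo, hlo⟩, -, b, hb, h0b⟩ := hnorm' i hi
      refine not_balanced_of_two_le hV (fun i hi => (hnorm i hi).2.2) hp hg hh hqN hF hcl hi ha hb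
        ?_ (hA.balanced fun i hi => ?_)
      · rw [← hadd i hi a ha, ← hadd i hi b hb]
        rw [hlo a ha] at hia
        rw [hlo b hb] at h0b
        omega
      · obtain ⟨⟨lo, hlo⟩, -⟩ := hnorm i hi
        exact ⟨lo, fun j hj => by rw [hlo j hj, hW i hi j hj]⟩

end ArrayProgram

/-! ### The machine program and its running time. -/

namespace ArrayProgram

open RAM

/-- `Stmt.time` depends on the format only; here it is a combination of 1, `M`, `N` and `M * N`,
each at most `M * N`. -/
theorem time_reconstruct_le {M N : ℕ} (hM : 0 < M) (hN : 0 < N) :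
    reconstruct.time M N ≤ 900 * (M * N) := by
  have hMX : M ≤ M * N := Nat.le_mul_of_pos_right M hN
  have hNX : N ≤ M * N := Nat.le_mul_of_pos_left N hM
  simp only [reconstruct, build, readEntry, clampEntry, accumulate, normalise, rowMin, priorities,
    countRow, raise, rowMaxima, threshold, addColumns, emit, Stmt.time, extent, if_true]
  simp only [Bool.false_eq_true, if_false]
  ring_nf
  omega

/-- The random access machine program: set up the base addresses of the arrays, run the compiled
reconstruction program and put the answer into register 0. -/
def machineProgram : Program :=
  [.mul 4 0 1, .add 5 4 4, .add 6 5 4, .add 7 6 4] ++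
    (compile reconstruct 4 ++ [.copy 0 13, .halt])

/-- Setting up the base addresses. -/
theorem leads_setup {M N B : ℕ} {P : Program} {σ : Config} {s : State} (hpc : σ.pc = 0)
    (hb : σ.BoundedBy B) (hB : 5 * (M * N) ≤ B)
    (hcode : CodeAt P 0 [.mul 4 0 1, .add 5 4 4, .add 6 5 4, .add 7 6 4])
    (h0 : σ.reg 0 = M) (h1 : σ.reg 1 = N) (h3 : σ.reg 3 = 0) (hvar : ∀ r, σ.reg (r + 8) = s.var r)
    (harr : ∀ k < 5, ∀ i < M, ∀ j < N, σ.mem (k * (M * N) + i * N + j) = s.arr k i j) :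
    ∃ σ', Reach P B σ 4 σ' ∧ σ'.pc = 4 ∧ Rep M N s σ' := by
  obtain ⟨f₁, f₂, f₃, f₄, -⟩ := hcode
  set x : ℤ := ((M * N : ℕ) : ℤ) with hx
  have b₁ := hb.setReg (z := x) (by omega) 4
  have b₂ := b₁.setReg (z := x + x) (by omega) 5
  have b₃ := b₂.setReg (z := x + x + x) (by omega) 6
  have b₄ := b₃.setReg (z := x + x + x + x) (by omega) 7
  refine ⟨_, .step hb (by rw [hpc]; exact f₁) (s₁ := σ.setReg 4 x) ?_ (.step b₁ (I := .add 5 4 4) ?_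
    (s₁ := (σ.setReg 4 x).setReg 5 (x + x)) ?_ (.step b₂ (I := .add 6 5 4) ?_
    (s₁ := ((σ.setReg 4 x).setReg 5 (x + x)).setReg 6 (x + x + x)) ?_ (.single (I := .add 7 6 4)
    b₃ ?_ ?_ b₄))), ?_, ?_, ?_, ?_, ?_, ?_⟩
  · simp [exec, h0, h1, hx]
  · simpa [Config.setReg, hpc] using f₂
  · simp [exec, Config.setReg]
  · simpa [Config.setReg, hpc] using f₃
  · simp [exec, Config.setReg]
  · simpa [Config.setReg, hpc] using f₄
  · simp [exec, Config.setReg]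
  · simp [Config.setReg, hpc]
  · simp [Config.setReg, h0]
  · simp [Config.setReg, h1]
  · intro k hk
    interval_cases k <;> simp [Config.setReg, h3, hx] <;> ring
  · intro r
    simp [Config.setReg, hvar]
  · exact harr

end ArrayProgram

/-! ### Input, output and size estimates for the matrix problem. -/

namespace WindowSum

open RAM ArrayProgram

variable {m n : ℕ}

/-- Extension of a matrix by zeros. -/
def extend (A : Matrix (Fin m) (Fin n) ℤ) (i j : ℕ) : ℤ :=
  if h : i < m ∧ j < n then A ⟨i, h.1⟩ ⟨j, h.2⟩ else 0

theorem extend_apply (A : Matrix (Fin m) (Fin n) ℤ) (i : Fin m) (j : Fin n) :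
    extend A i j = A i j := by
  simp [extend]

theorem isSolution_extend {S : Matrix (Fin m) (Fin n) ℤ}
    {A : Matrix (Fin (m + 1)) (Fin (n + 1)) ℤ} (h : IsPreimage S A) :
    IsSolution m n (extend S) (extend A) := by
  refine ⟨fun i hi j hj => ?_, fun i hi j hj => ?_⟩
  · simpa [extend, hi, hj] using h.1 ⟨i, hi⟩ ⟨j, hj⟩
  · have := congrFun (congrFun h.2 ⟨i, hi⟩) ⟨j, hj⟩
    simp only [windowSum, ← extend_apply] at this
    simpa using this

theorem isPreimage_of_isSolution {S : Matrix (Fin m) (Fin n) ℤ} {A : ℕ → ℕ → ℤ}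
    (h : IsSolution m n (extend S) A) : IsPreimage S fun i j => A i j := by
  refine ⟨fun i j => h.1 i i.2 j j.2, ?_⟩
  funext i j
  have := h.2 i i.2 j j.2
  rw [extend_apply] at this
  simpa [windowSum] using this

theorem natAbs_le_maxAbs (S : Matrix (Fin m) (Fin n) ℤ) (i : Fin m) (j : Fin n) :
    (S i j).natAbs ≤ maxAbs S :=
  (Finset.le_sup (f := fun j => (S i j).natAbs) (Finset.mem_univ j)).trans
    (Finset.le_sup (f := fun i => Finset.univ.sup fun j => (S i j).natAbs) (Finset.mem_univ i))

theorem maxAbs_lt (S : Matrix (Fin m) (Fin n) ℤ) : maxAbs S < 2 ^ inputLength S := by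
  have hpos : (⊥ : ℕ) < 2 ^ inputLength S := by simp
  refine (Finset.sup_lt_iff hpos).2 fun i _ => (Finset.sup_lt_iff hpos).2 fun j _ => ?_
  refine (Nat.lt_size_self _).trans_le (Nat.pow_le_pow_right (by omega) ?_)
  have h₁ : len (S i j) ≤ ∑ j, len (S i j) :=
    Finset.single_le_sum (f := fun j => len (S i j)) (fun _ _ => Nat.zero_le _) (Finset.mem_univ j)
  have h₂ : ∑ j, len (S i j) ≤ ∑ i, ∑ j, len (S i j) :=
    Finset.single_le_sum (f := fun i => ∑ j, len (S i j)) (fun _ _ => Nat.zero_le _)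
      (Finset.mem_univ i)
  rw [len] at h₁
  rw [inputLength]
  omega

theorem mul_le_inputLength_sq (S : Matrix (Fin m) (Fin n) ℤ) :
    (m + 1) * (n + 1) ≤ inputLength S ^ 2 := by
  rw [sq]
  exact Nat.mul_le_mul (by rw [inputLength]; omega) (by rw [inputLength]; omega)

/-- With L the input length, both summands are at most 4 ^ L, and 2 * 1000 < 2 ^ 11. -/
theorem size_bound_le (S : Matrix (Fin m) (Fin n) ℤ) :
    (1000 * ((m + 1) * (n + 1) + maxAbs S)).size ≤ 2 * inputLength S + 11 := by
  rw [Nat.size_le]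
  have h₁ := maxAbs_lt S
  have h₂ := mul_le_inputLength_sq S
  have h₃ : inputLength S < 2 ^ inputLength S := Nat.lt_two_pow_self
  have h₄ : inputLength S ^ 2 ≤ (2 ^ inputLength S) ^ 2 := Nat.pow_le_pow_left h₃.le 2
  have h₅ : 2 ^ inputLength S ≤ (2 ^ inputLength S) ^ 2 := Nat.le_self_pow (by omega) _
  have h₆ : 2 ^ (2 * inputLength S + 11) = 2048 * (2 ^ inputLength S) ^ 2 := by
    rw [pow_add, mul_comm 2, pow_mul]; ring
  omega

theorem input_boundedBy (S : Matrix (Fin m) (Fin n) ℤ) {B : ℕ}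
    (hB : (m + 1) * (n + 1) + maxAbs S ≤ B) : (input S).BoundedBy B := by
  have h₁ : m + 1 ≤ (m + 1) * (n + 1) := Nat.le_mul_of_pos_right _ (by omega)
  have h₂ : n + 1 ≤ (m + 1) * (n + 1) := Nat.le_mul_of_pos_left _ (by omega)
  refine ⟨fun r => ?_, fun a => ?_⟩
  · simp only [input]
    split_ifs <;> omega
  · simp only [input]
    split_ifs with h
    · have := natAbs_le_maxAbs S (Fin.divNat ⟨a, h⟩) (Fin.modNat ⟨a, h⟩)
      omega
    · simp

theorem input_mem (S : Matrix (Fin m) (Fin n) ℤ) {i j : ℕ} (hi : i < m) (hj : j < n) :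
    (input S).mem (i * n + j) = extend S i j := by
  have hlt := mul_add_lt hi hj
  have hd : (i * n + j) / n = i := by
    rw [mul_comm, Nat.mul_add_div (by omega), Nat.div_eq_of_lt hj, add_zero]
  have hm : (i * n + j) % n = j := by
    rw [mul_comm, Nat.mul_add_mod, Nat.mod_eq_of_lt hj]
  simp only [input, dif_pos hlt, extend, hi, hj, and_self, dite_true]
  congr 1 <;> apply Fin.ext <;> simp [hd, hm]

theorem input_mem_of_le (S : Matrix (Fin m) (Fin n) ℤ) {a : ℕ} (h : m * n ≤ a) :
    (input S).mem a = 0 := by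
  simp [input, h]

/-- The program halts in linear time, with bounded registers and memory, and with a correct
answer. -/
theorem reach_answer (S : Matrix (Fin m) (Fin n) ℤ) {B : ℕ}
    (hB : 20 * ((m + 1) * (n + 1)) + maxAbs S ≤ B) :
    ∃ t s, t ≤ 1000 * ((m + 1) * (n + 1)) ∧ Reach machineProgram B (input S) t s ∧
      Halted machineProgram s ∧ Answers S s := by
  have hcode : CodeAt machineProgram 0 machineProgram := codeAt_self
  rw [machineProgram, codeAt_append, codeAt_append, ← machineProgram, length_compile] at hcode
  obtain ⟨c₁, c₂, c₃, c₄, -⟩ := hcode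
  simp only [List.length_cons, List.length_nil, zero_add] at c₂ c₃ c₄
  have hmn : m * n ≤ (m + 1) * (n + 1) := Nat.mul_le_mul (by omega) (by omega)
  have hX : 0 < (m + 1) * (n + 1) := by positivity
  -- The initial memory viewed as five arrays. The input fits into array 0, so the other four are
  -- zero.
  let s₀ : State := ⟨fun _ => 0,
    fun k i j => (input S).mem (k * ((m + 1) * (n + 1)) + i * (n + 1) + j)⟩
  obtain ⟨σ₁, hr₁, hpc₁, hrep₁⟩ := leads_setup (M := m + 1) (N := n + 1) (B := B) (s := s₀)
    (σ := input S) rfl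
    (input_boundedBy S (by omega)) (by omega) c₁ (by simp [input]) (by simp [input])
    (by simp [input]) (by simp [input, s₀]) (fun _ _ _ _ _ _ => rfl)
  have hwp : wp (m + 1) (n + 1) B reconstruct (fun s' =>
      s'.var 5 = 1 ∧ IsSolution m n (extend S) (s'.arr 0) ∨
        s'.var 5 = 0 ∧ ¬ ∃ A, IsSolution m n (extend S) A) s₀ := by
    refine wp_reconstruct (S := extend S) (K := maxAbs S) rfl rfl (fun i j => ?_) (fun j hj => ?_)
      (fun i j hi hj => ?_) (fun i j hi hj => ?_) hB (fun s' h => h)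
    · exact input_mem_of_le S (by omega)
    · exact input_mem_of_le S (by omega)
    · rw [← input_mem S hi hj]
      simp only [s₀, zero_mul, zero_add]
      rw [mul_comm, Nat.div_add_mod]
    · rw [extend, dif_pos ⟨hi, hj⟩]
      exact natAbs_le_maxAbs S _ _
  obtain ⟨t, s', σ₂, ht, hr₂, hpc₂, hrep₂, hans⟩ := leads_of_wp (by omega) (by omega) (by omega)
    reconstruct c₂ hr₁.right hrep₁ hpc₁ hwp
  have htime := time_reconstruct_le (M := m + 1) (N := n + 1) (by omega) (by omega)
  -- Register 13 holds variable 5, the answer.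
  have hr₃ : Reach machineProgram B σ₂ 1 (σ₂.setReg 0 (σ₂.reg 13)) :=
    .single hr₂.right (by rw [hpc₂]; exact c₃) rfl (hr₂.right.setReg (hr₂.right.1 _) _)
  refine ⟨4 + t + 1, _, by omega, (hr₁.trans hr₂).trans hr₃, ?_, ?_⟩
  · rw [Halted]
    simpa [Config.setReg, hpc₂] using c₄
  · have hreg : (σ₂.setReg 0 (σ₂.reg 13)).reg 0 = s'.var 5 := by
      simpa [Config.setReg] using hrep₂.var 5
    rw [Answers, hreg]
    refine hans.imp (fun h => ⟨h.1, ?_⟩) (fun h => ⟨h.1, ?_⟩)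
    · have heq : output (m + 1) (n + 1) (σ₂.setReg 0 (σ₂.reg 13)) =
          fun (i : Fin (m + 1)) (j : Fin (n + 1)) => s'.arr 0 i j := by
        funext i j
        simpa [output, Config.setReg] using hrep₂.arr 0 (by omega) i i.2 j j.2
      rw [heq]
      exact isPreimage_of_isSolution h.2
    · rintro ⟨A, hA⟩
      exact h.2 ⟨_, isSolution_extend hA⟩

end WindowSum

/-- One program finds a 0-1 matrix with the given sums over `2 × 2` windows, or reports that there
is none. Its number of steps is linear in the number of entries of the matrix, it uses only words of
logarithmic length (numbers bounded by a multiple of the number of entries plus the largest input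
number), and its logarithmic cost, hence its bit complexity, is polynomial in the length of the
input. -/
theorem theorem1 :
    ∃ (P : RAM.Program) (c : ℕ) (p : Polynomial ℕ),
      ∀ (m n : ℕ) (S : Matrix (Fin m) (Fin n) ℤ),
        (∃ (t w : ℕ) (s : RAM.Config),
          RAM.Run P (WindowSum.input S) t w s ∧ RAM.Halted P s ∧ WindowSum.Answers S s ∧
            t ≤ c * ((m + 1) * (n + 1)) ∧
            w ≤ p.eval (WindowSum.inputLength S)) ∧
        ∀ (t w : ℕ) (s : RAM.Config), RAM.Run P (WindowSum.input S) t w s →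
          s.BoundedBy (c * ((m + 1) * (n + 1) + WindowSum.maxAbs S)) := by

  -- With L the input length, there are at most 1000 L^2 steps. Each handles at most two numbers of
  -- length at most 2 L + 12, namely 2 L + 11 bits and a sign.
  refine ⟨ArrayProgram.machineProgram, 1000, .C 1000 * .X ^ 2 * (.C 2 * (.C 2 * .X + .C 12)),
    fun m n S => ?_⟩
  have hX : 0 < (m + 1) * (n + 1) := by positivity
  obtain ⟨t, s, ht, hr, hhalt, hans⟩ := WindowSum.reach_answer S
    (B := 1000 * ((m + 1) * (n + 1) + WindowSum.maxAbs S)) (by omega)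
  refine ⟨?_, fun t' w' s' hrun => hr.boundedBy_of_run hhalt hrun⟩
  obtain ⟨w, hw, hrun⟩ := hr.run
  refine ⟨t, w, s, hrun, hhalt, hans, ht, hw.trans ?_⟩
  simp only [Polynomial.eval_mul, Polynomial.eval_C, Polynomial.eval_pow, Polynomial.eval_X,
    Polynomial.eval_add]
  have h₁ := WindowSum.size_bound_le S
  have h₂ := WindowSum.mul_le_inputLength_sq S
  exact Nat.mul_le_mul (ht.trans (Nat.mul_le_mul_left _ h₂)) (by omega)
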